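/- Let $\hbar>0$ and let $Q$, $P=-i\hbar\,d/dx$ be the position and momentum operators on $\mathcal H=L^2(\mathbb R)$, with spectral measures $\mathsf Q,\mathsf P$. A state is a positive operator $\rho$ on $\mathcal H$ of trace $1$; for a normalised positive operator measure (observable) $\mathsf E$ on $\mathbb R$ write $\rho^{\mathsf E}(X)=\operatorname{tr}(\rho\,\mathsf E(X))$. Put $J_{x;w}=[x-\tfrac w2,x+\tfrac w2]$. For $\varepsilon\in[0,1)$ and a probability measure $p$ on $\mathbb R$ let $W_\varepsilon(p)=\inf\{w>0 : \exists x\in\mathbb R,\ p(J_{x;w})\ge 1-\varepsilon\}$. For observables $\mathsf E_1$ and $\mathsf E$ on $\mathbb R$ with $\mathsf E$ projection valued, $\varepsilon\in(0,1)$ and $\delta>0$, let $$\mathcal W_{\varepsilon,\delta}(\mathsf E_1,\mathsf E)=\inf\{w>0 : \forall x\in\mathbb R\ \forall\rho,\ \rho^{\mathsf E}(J_{x;\delta})=1\Rightarrow\rho^{\mathsf E_1}(J_{x;w})\ge 1-\varepsilon\},\qquad \mathcal W_\varepsilon(\mathsf E_1,\mathsf E)=\inf_{\delta>0}\mathcal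 W_{\varepsilon,\delta}(\mathsf E_1,\mathsf E)$$ (the gross error bar width), and $$\mathcal W^0_{\varepsilon,\delta}(\mathsf E_1,\mathsf E)=\sup\{W_\varepsilon(\rho^{\mathsf E_1}) : W_0(\rho^{\mathsf E})\le\delta\},\qquad \mathcal W^0_\varepsilon(\mathsf E_1,\mathsf E)=\lim_{\delta\to0}\mathcal W^0_{\varepsilon,\delta}(\mathsf E_1,\mathsf E)$$ (the bias-free error bar width), all with values in $[0,\infty]$ and $\inf\emptyset=\infty$. Let $W(q,p)=e^{iqp/2\hbar}e^{-iqP/\hbar}e^{ipQ/\hbar}$, let $\tau$ be a positive operator of trace $1$, and let $\mathsf G^\tau(Z)=\frac1{2\pi\hbar}\int_Z W(q,p)\,\tau\, W(q,p)^*\,dq\,dp$ (weak integral, $Z\subseteq\mathbb R^2$ Borel) be the covariant phase space observable generated by $\tau$. Let $\mu_\tau,\nu_\tau$ be the distributions of $Q$ and $P$ in the state $\Pi\tau\Pi^*$, where $(\Pi\varphi)(x)=\varphi(-x)$, and let $\mathsf Q^{\mu}(X)=\int\mu(X-q)\,\mathsf Q(dq)$, $\mathsf P^{\nu}(Y)=\int\nu(Y-p)\,\mathsf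 P(dp)$. Then the marginals of $\mathsf G^\tau$ are $\mathsf G^\tau(X\times\mathbb R)=\mathsf Q^{\mu_\tau}(X)$ and $\mathsf G^\tau(\mathbb R\times Y)=\mathsf P^{\nu_\tau}(Y)$ for all Borel $X,Y\subseteq\mathbb R$. For all $\varepsilon_1,\varepsilon_2\in(0,1)$ the gross error bar widths $\mathcal W_{\varepsilon_1}(\mathsf Q^{\mu_\tau},\mathsf Q)$ and $\mathcal W_{\varepsilon_2}(\mathsf P^{\nu_\tau},\mathsf P)$ are finite, and $$\mathcal W_{\varepsilon_1}(\mathsf Q^{\mu_\tau},\mathsf Q)\,\mathcal W_{\varepsilon_2}(\mathsf P^{\nu_\tau},\mathsf P)\ \ge\ \mathcal W^0_{\varepsilon_1}(\mathsf Q^{\mu_\tau},\mathsf Q)\,\mathcal W^0_{\varepsilon_2}(\mathsf P^{\nu_\tau},\mathsf P).$$ If moreover $\varepsilon_1+\varepsilon_2<1$, then $$\mathcal W^0_{\varepsilon_1}(\mathsf Q^{\mu_\tau},\mathsf Q)\,\mathcal W^0_{\varepsilon_2}(\mathsf P^{\nu_\tau},\mathsf P)\ \ge\ 2\pi\hbar\,K(\varepsilon_1,\varepsilon_2),\qquad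 K(\varepsilon_1,\varepsilon_2)=\Bigl(\sqrt{(1-\varepsilon_1)(1-\varepsilon_2)}-\sqrt{\varepsilon_1\varepsilon_2}\Bigr)^2 .$$ -/

import Mathlib

open MeasureTheory ProbabilityTheory
open scoped ENNReal InnerProductSpace InnerProduct

noncomputable section

namespace PhaseSpace

/-! ### Trace, density operators and observables on a complex Hilbert space -/

section General

variable {H : Type*} [NormedAddCommGroup H] [InnerProductSpace ℂ H] [CompleteSpace H]

variable (H) in
/-- The index set of a fixed Hilbert basis of `H`. -/
def traceIndex : Set H := (exists_hilbertBasis ℂ H).choose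

variable (H) in
/-- A fixed Hilbert basis of `H`, used to compute traces. -/
def traceBasis : HilbertBasis (traceIndex H) ℂ H :=
  (exists_hilbertBasis ℂ H).choose_spec.choose

/-- The trace `∑ᵢ ⟨eᵢ, A eᵢ⟩`; for trace class `A` it does not depend on the basis. -/
def trace (A : H →L[ℂ] H) : ℂ := ∑' i, ⟪traceBasis H i, A (traceBasis H i)⟫_ℂ

variable (H) in
/-- A state: a positive operator of trace one. (For a positive operator the series defining the
trace has nonnegative terms, so trace one includes convergence, that is, trace class.) -/
structure DensityOperator where
  op : H →L[ℂ] H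
  isPositive : op.IsPositive
  trace_eq_one : trace op = 1

/-- A normalised positive operator measure on the measurable space `Ω`. Only the values on
measurable sets are meaningful. -/
structure Observable (Ω : Type*) [MeasurableSpace Ω] (H : Type*) [NormedAddCommGroup H]
    [InnerProductSpace ℂ H] [CompleteSpace H] where
  effect : Set Ω → H →L[ℂ] H
  isPositive : ∀ X, MeasurableSet X → (effect X).IsPositive
  effect_univ : effect Set.univ = 1
  hasSum_effect : ∀ X : ℕ → Set Ω, (∀ n, MeasurableSet (X n)) →
    Pairwise (Function.onFun Disjoint X) → ∀ φ ψ : H,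
      HasSum (fun n => ⟪φ, effect (X n) ψ⟫_ℂ) ⟪φ, effect (⋃ n, X n) ψ⟫_ℂ

/-- The weak integral `∫ f dν` of an operator valued function: the bounded operator `T` with
`⟨φ, T ψ⟩ = ∫ ⟨φ, f(x) ψ⟩ dν(x)` for all `φ, ψ` (and `0` if there is none). -/
def weakIntegral {Ω : Type*} [MeasurableSpace Ω] (ν : Measure Ω) (f : Ω → H →L[ℂ] H) :
    H →L[ℂ] H :=
  open Classical in
  if h : ∃ T : H →L[ℂ] H, ∀ φ ψ : H, Integrable (fun x => ⟪φ, f x ψ⟫_ℂ) ν ∧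
      ⟪φ, T ψ⟫_ℂ = ∫ x, ⟪φ, f x ψ⟫_ℂ ∂ν
  then h.choose else 0

set_option linter.unusedSectionVars false in
theorem enorm_sq_eq_tsum {ι : Type*} (e : HilbertBasis ι ℂ H) (x : H) :
    HasSum (fun i => ‖⟪x, e i⟫_ℂ‖ ^ 2) (‖x‖ ^ 2) ∧
      ‖x‖ₑ ^ 2 = ∑' i, ‖⟪x, e i⟫_ℂ‖ₑ ^ 2 := by
  have h := e.hasSum_inner_mul_inner x x
  have h2 : HasSum (fun i => ‖⟪x, e i⟫_ℂ‖ ^ 2) (‖x‖ ^ 2) := by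
    have := (Complex.hasSum_re h)
    convert this using 1
    · funext i
      rw [← inner_conj_symm (e i) x, Complex.mul_conj, Complex.ofReal_re,
        Complex.normSq_eq_norm_sq]
    · rw [inner_self_eq_norm_sq_to_K]; norm_cast
  refine ⟨h2, ?_⟩
  have h3 := congrArg ENNReal.ofReal h2.tsum_eq
  rw [ENNReal.ofReal_tsum_of_nonneg (fun _ => by positivity) h2.summable] at h3
  simpa [ENNReal.ofReal_pow, ofReal_norm] using h3.symm

theorem tsum_enorm_adjoint {ι κ : Type*} (e : HilbertBasis ι ℂ H) (f : HilbertBasis κ ℂ H)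
    (T : H →L[ℂ] H) : ∑' i, ‖T (e i)‖ₑ ^ 2 = ∑' j, ‖T.adjoint (f j)‖ₑ ^ 2 := by
  calc ∑' i, ‖T (e i)‖ₑ ^ 2 = ∑' i, ∑' j, ‖⟪T (e i), f j⟫_ℂ‖ₑ ^ 2 :=
        tsum_congr fun i => (enorm_sq_eq_tsum f _).2
    _ = ∑' j, ∑' i, ‖⟪T (e i), f j⟫_ℂ‖ₑ ^ 2 := ENNReal.tsum_comm
    _ = ∑' j, ∑' i, ‖⟪T.adjoint (f j), e i⟫_ℂ‖ₑ ^ 2 := by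
        refine tsum_congr fun j => tsum_congr fun i => ?_
        rw [ContinuousLinearMap.adjoint_inner_left, ← ofReal_norm, ← ofReal_norm, norm_inner_symm]
    _ = _ := tsum_congr fun j => (enorm_sq_eq_tsum e _).2.symm

theorem trace_adjoint_comp_self (T : H →L[ℂ] H) :
    trace (T.adjoint ∘L T) = ((∑' i, ‖T (traceBasis H i)‖ₑ ^ 2).toReal : ℂ) := by
  rw [ENNReal.tsum_toReal_eq (fun i => by finiteness), Complex.ofReal_tsum]
  refine tsum_congr fun i => ?_
  rw [ContinuousLinearMap.comp_apply, ContinuousLinearMap.adjoint_inner_right,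
    inner_self_eq_norm_sq_to_K]
  simp

namespace DensityOperator

variable (ρ : DensityOperator H)

/-- The positive square root of the density operator. -/
def root : H →L[ℂ] H := CFC.sqrt ρ.op

theorem root_adjoint : ρ.root.adjoint = ρ.root :=
  ((ContinuousLinearMap.nonneg_iff_isPositive _).1 (CFC.sqrt_nonneg ρ.op)).isSelfAdjoint.adjoint_eq

theorem root_comp_root : ρ.root ∘L ρ.root = ρ.op :=
  CFC.sqrt_mul_sqrt_self ρ.op ((ContinuousLinearMap.nonneg_iff_isPositive _).2 ρ.isPositive)

theorem tsum_enorm_root : ∑' i, ‖ρ.root (traceBasis H i)‖ₑ ^ 2 = 1 := by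
  have h := ρ.trace_eq_one
  rw [← ρ.root_comp_root] at h
  nth_rewrite 1 [← ρ.root_adjoint] at h
  rw [trace_adjoint_comp_self] at h
  exact (ENNReal.toReal_eq_one_iff _).1 (by exact_mod_cast h)

theorem summable_norm_root : Summable fun i => ‖ρ.root (traceBasis H i)‖ ^ 2 := by
  have h : ∑' i, ‖ρ.root (traceBasis H i)‖ₑ ^ 2 ≠ ∞ := by simp [ρ.tsum_enorm_root]
  simpa using ENNReal.summable_toReal h

/-- `tr(ρ A) = tr(ρ^{1/2} A ρ^{1/2})`, with convergence of the right hand series. -/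
theorem hasSum_trace_comp (A : H →L[ℂ] H) :
    HasSum (fun i => ⟪ρ.root (traceBasis H i), A (ρ.root (traceBasis H i))⟫_ℂ)
      (trace (ρ.op ∘L A)) := by
  set e := traceBasis H
  set s := ρ.root with hs
  have hadj : ∀ x y : H, ⟪s x, y⟫_ℂ = ⟪x, s y⟫_ℂ := fun x y => by
    rw [← ContinuousLinearMap.adjoint_inner_right, hs, ρ.root_adjoint]
  obtain ⟨f, hf⟩ : ∃ f : traceIndex H × traceIndex H → ℂ, ∀ p, f p =
    ⟪s (e p.1), e p.2⟫_ℂ * ⟪e p.2, s (A (e p.1))⟫_ℂ := ⟨_, fun _ => rfl⟩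
  have h1 : Summable fun p : traceIndex H × traceIndex H => ‖⟪s (e p.1), e p.2⟫_ℂ‖ ^ 2 := by
    refine (summable_prod_of_nonneg (fun _ => by positivity)).2 ⟨fun i => ?_, ?_⟩
    · exact (enorm_sq_eq_tsum e (s (e i))).1.summable
    · simpa only [(enorm_sq_eq_tsum e (s (e _))).1.tsum_eq] using ρ.summable_norm_root
  have h2 : Summable fun p : traceIndex H × traceIndex H =>
      ‖⟪A.adjoint (s (e p.1)), e p.2⟫_ℂ‖ ^ 2 := by
    refine (summable_prod_of_nonneg (fun _ => by positivity)).2 ⟨fun i => ?_, ?_⟩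
    · exact (enorm_sq_eq_tsum e (A.adjoint (s (e i)))).1.summable
    · simp only [(enorm_sq_eq_tsum e (A.adjoint (s (e _)))).1.tsum_eq]
      refine Summable.of_nonneg_of_le (fun _ => by positivity) (fun i => ?_)
        (ρ.summable_norm_root.mul_left (‖A.adjoint‖ ^ 2))
      rw [← mul_pow]
      gcongr
      exact A.adjoint.le_opNorm _
  have hswap : ∀ i j, ⟪e j, s (A (e i))⟫_ℂ = ⟪A.adjoint (s (e j)), e i⟫_ℂ := fun i j => by
    rw [ContinuousLinearMap.adjoint_inner_left, hadj]
  have h2' : Summable fun p : traceIndex H × traceIndex H =>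
      ‖⟪A.adjoint (s (e p.2)), e p.1⟫_ℂ‖ ^ 2 := h2.prod_symm
  have h3 : Summable f := by
    refine Summable.of_norm_bounded (h1.add h2') fun p => ?_
    rw [hf, hswap, norm_mul]
    have hab : ∀ a b : ℝ, a * b ≤ a ^ 2 + b ^ 2 := fun a b => by
      nlinarith [sq_nonneg (a - b), sq_nonneg (a + b)]
    exact hab _ _
  have hrow : ∀ i, HasSum (fun j => f (i, j)) ⟪e i, ρ.op (A (e i))⟫_ℂ := fun i => by
    have := e.hasSum_inner_mul_inner (s (e i)) (s (A (e i)))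
    have h6 : s (s (A (e i))) = ρ.op (A (e i)) := by rw [← ρ.root_comp_root]; rfl
    rw [hadj, h6] at this
    simpa only [hf] using this
  have hcol : ∀ j, HasSum (fun i => f (i, j)) ⟪s (e j), A (s (e j))⟫_ℂ := fun j => by
    have := e.hasSum_inner_mul_inner (A.adjoint (s (e j))) (s (e j))
    rw [ContinuousLinearMap.adjoint_inner_left] at this
    have h7 : (fun i => f (i, j)) = fun i =>
        ⟪A.adjoint (s (e j)), e i⟫_ℂ * ⟪e i, s (e j)⟫_ℂ := by
      funext i
      rw [hf, hswap, mul_comm, hadj]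
    rw [h7]
    exact this
  have ht : HasSum f (trace (ρ.op ∘L A)) := by
    have h4 := h3.hasSum.prod_fiberwise hrow
    have h5 : trace (ρ.op ∘L A) = ∑' p, f p := h4.tsum_eq
    rw [h5]; exact h3.hasSum
  have ht' : HasSum (fun p : traceIndex H × traceIndex H => f p.swap) (trace (ρ.op ∘L A)) :=
    (Equiv.prodComm (traceIndex H) (traceIndex H)).hasSum_iff.2 ht
  exact ht'.prod_fiberwise hcol

/-- The probability `tr(ρ E(X))`. -/
def prob {Ω : Type*} [MeasurableSpace Ω] (E : Observable Ω H) (X : Set Ω) : ℝ :=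
  (trace (ρ.op ∘L E.effect X)).re

theorem ofReal_prob {Ω : Type*} [MeasurableSpace Ω] (E : Observable Ω H) {X : Set Ω}
    (hX : MeasurableSet X) :
    ENNReal.ofReal (ρ.prob E X) = ∑' i, ENNReal.ofReal
      (⟪ρ.root (traceBasis H i), E.effect X (ρ.root (traceBasis H i))⟫_ℂ).re := by
  have h := Complex.hasSum_re (ρ.hasSum_trace_comp (E.effect X))
  rw [prob, ← h.tsum_eq]
  exact ENNReal.ofReal_tsum_of_nonneg
    (fun i => (E.isPositive X hX).re_inner_nonneg_right _) h.summable

/-- The probability measure `X ↦ tr(ρ E(X))` of the observable `E` in the state `ρ`. -/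
def bornMeasure {Ω : Type*} [MeasurableSpace Ω] (E : Observable Ω H) : Measure Ω :=
  Measure.ofMeasurable (fun X _ => ENNReal.ofReal (ρ.prob E X))
    (by
      have h : E.effect ∅ = 0 := by
        refine ContinuousLinearMap.ext fun ψ => ?_
        have h := (E.hasSum_effect (fun _ => ∅) (fun _ => MeasurableSet.empty)
          (fun _ _ _ => by simp [Function.onFun]) (E.effect ∅ ψ) ψ).summable.tendsto_atTop_zero
        rw [tendsto_const_nhds_iff] at h
        simpa using h
      simp [prob, h, trace])
    (by
      intro X hX hd
      rw [ρ.ofReal_prob E (MeasurableSet.iUnion hX)]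
      simp_rw [fun n => ρ.ofReal_prob E (hX n)]
      rw [ENNReal.tsum_comm]
      refine tsum_congr fun i => ?_
      have h := Complex.hasSum_re (E.hasSum_effect X hX hd (ρ.root (traceBasis H i))
        (ρ.root (traceBasis H i)))
      rw [← h.tsum_eq]
      exact ENNReal.ofReal_tsum_of_nonneg
        (fun n => (E.isPositive _ (hX n)).re_inner_nonneg_right _) h.summable)

theorem bornMeasure_apply {Ω : Type*} [MeasurableSpace Ω] (E : Observable Ω H) {X : Set Ω}
    (hX : MeasurableSet X) : ρ.bornMeasure E X = ENNReal.ofReal (ρ.prob E X) :=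
  Measure.ofMeasurable_apply X hX

instance {Ω : Type*} [MeasurableSpace Ω] (E : Observable Ω H) :
    IsProbabilityMeasure (ρ.bornMeasure E) := by
  refine ⟨?_⟩
  have h : ρ.op ∘L (1 : H →L[ℂ] H) = ρ.op := mul_one ρ.op
  rw [ρ.bornMeasure_apply E MeasurableSet.univ, prob, E.effect_univ, h, ρ.trace_eq_one]
  simp

/-- The state `U ρ U*` for an isometry `U`. -/
def conj (U : H →ₗᵢ[ℂ] H) : DensityOperator H where
  op := U.toContinuousLinearMap ∘L ρ.op ∘L U.toContinuousLinearMap.adjoint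
  isPositive := ρ.isPositive.conj_adjoint _
  trace_eq_one := by
    set V := U.toContinuousLinearMap
    have h : V ∘L ρ.op ∘L V.adjoint
        = ((V ∘L ρ.root).adjoint).adjoint ∘L (V ∘L ρ.root).adjoint := by
      rw [ContinuousLinearMap.adjoint_adjoint, ContinuousLinearMap.adjoint_comp, ρ.root_adjoint,
        ← ρ.root_comp_root]
      rfl
    rw [h, trace_adjoint_comp_self, ← tsum_enorm_adjoint (traceBasis H) (traceBasis H)]
    have h2 : ∀ x, ‖(V ∘L ρ.root) x‖ₑ = ‖ρ.root x‖ₑ := fun x => by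
      rw [← ofReal_norm, ← ofReal_norm]
      exact congrArg _ (U.norm_map _)
    rw [tsum_congr fun i => by rw [h2], ρ.tsum_enorm_root]
    simp

end DensityOperator

/-- The observable `X ↦ U* E(X) U` for a unitary `U`. -/
def Observable.conj {Ω : Type*} [MeasurableSpace Ω] (E : Observable Ω H) (U : H ≃ₗᵢ[ℂ] H) :
    Observable Ω H where
  effect X := (U.symm : H →L[ℂ] H) ∘L E.effect X ∘L (U : H →L[ℂ] H)
  isPositive X hX := by
    have h : (U.symm : H →L[ℂ] H) = (U : H →L[ℂ] H).adjoint := by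
      simp
    rw [h]
    exact (E.isPositive X hX).adjoint_conj _
  effect_univ := by
    ext ψ
    simp [E.effect_univ]
  hasSum_effect X hX hd φ ψ := by
    have h := E.hasSum_effect X hX hd (U φ) (U ψ)
    have h2 : ∀ x, ⟪φ, U.symm x⟫_ℂ = ⟪U φ, x⟫_ℂ := fun x => by
      rw [← U.inner_map_map φ, U.apply_symm_apply]
    simpa [h2] using h

/-! ### Overall width and error bar widths -/

/-- The closed interval `[x - w/2, x + w/2]`. -/
def interval (x w : ℝ) : Set ℝ := Set.Icc (x - w / 2) (x + w / 2)

/-- The overall width of a probability measure on `ℝ` at confidence level `1 - ε`, that is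
`inf {w > 0 | ∃ x, p([x - w/2, x + w/2]) ≥ 1 - ε}` (infinite if there is no such `w`). -/
def overallWidth (ε : ℝ) (p : Measure ℝ) : ℝ≥0∞ :=
  ⨅ (w : ℝ) (_ : 0 < w) (_ : ∃ x, ENNReal.ofReal (1 - ε) ≤ p (interval x w)), ENNReal.ofReal w

/-- The error of `E₁` relative to `E` for inputs localised within `δ`: the infimum of all `w > 0`
such that the outputs of `E₁` lie in `[x - w/2, x + w/2]` with probability at least `1 - ε`
whenever `E` is localised in `[x - δ/2, x + δ/2]`. -/
def grossError (ε δ : ℝ) (E₁ E : Observable ℝ H) : ℝ≥0∞ :=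
  ⨅ (w : ℝ) (_ : 0 < w) (_ : ∀ (x : ℝ) (ρ : DensityOperator H),
    ρ.bornMeasure E (interval x δ) = 1 →
      ENNReal.ofReal (1 - ε) ≤ ρ.bornMeasure E₁ (interval x w)), ENNReal.ofReal w

/-- The gross error bar width: the infimum over `δ > 0` of the errors. -/
def grossErrorBarWidth (ε : ℝ) (E₁ E : Observable ℝ H) : ℝ≥0∞ :=
  ⨅ (δ : ℝ) (_ : 0 < δ), grossError ε δ E₁ E

/-- The bias-free error: the supremum of the overall output widths over all inputs whose overall
width at confidence level one is at most `δ`. -/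
def biasFreeError (ε δ : ℝ) (E₁ E : Observable ℝ H) : ℝ≥0∞ :=
  ⨆ (ρ : DensityOperator H) (_ : overallWidth 0 (ρ.bornMeasure E) ≤ ENNReal.ofReal δ),
    overallWidth ε (ρ.bornMeasure E₁)

/-- The bias-free error bar width: the limit as `δ → 0` of the bias-free errors, see
`tendsto_biasFreeError`. -/
def biasFreeErrorBarWidth (ε : ℝ) (E₁ E : Observable ℝ H) : ℝ≥0∞ :=
  ⨅ (δ : ℝ) (_ : 0 < δ), biasFreeError ε δ E₁ E

theorem tendsto_biasFreeError (ε : ℝ) (E₁ E : Observable ℝ H) :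
    Filter.Tendsto (fun δ => biasFreeError ε δ E₁ E) (nhdsWithin 0 (Set.Ioi 0))
      (nhds (biasFreeErrorBarWidth ε E₁ E)) := by
  have hm : Monotone fun δ => biasFreeError ε δ E₁ E := fun δ δ' h =>
    iSup_mono fun ρ => iSup_mono' fun h' => ⟨h'.trans (ENNReal.ofReal_le_ofReal h), le_rfl⟩
  have := hm.tendsto_nhdsGT 0
  rwa [sInf_image] at this

end General

/-! ### Position and momentum on `L²(ℝ)` -/

/-- The Hilbert space `L²(ℝ)`. -/
abbrev L2R : Type := Lp ℂ 2 (volume : Measure ℝ)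

/-- Multiplication by `f`, that is `f(Q)`, for an (essentially) bounded measurable `f`. -/
def mulOp (f : ℝ → ℂ) : L2R →L[ℂ] L2R :=
  open Classical in
  if hf : MemLp f ∞ (volume : Measure ℝ)
  then (ContinuousLinearMap.mul ℂ ℂ).holderL volume ∞ 2 2 (hf.toLp f) else 0

theorem mulOp_apply {f : ℝ → ℂ} (hf : MemLp f ∞ (volume : Measure ℝ)) (ψ : L2R) :
    mulOp f ψ =ᵐ[volume] fun x => f x * ψ x := by
  rw [mulOp, dif_pos hf]
  filter_upwards [(ContinuousLinearMap.mul ℂ ℂ).coeFn_holder (r := 2) (hf.toLp f) ψ,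
    hf.coeFn_toLp] with x hx hx'
  simp only [ContinuousLinearMap.holderL_apply_apply]
  rw [hx, hx']
  rfl

theorem memLp_kernel (κ : Kernel ℝ ℝ) [IsMarkovKernel κ] {X : Set ℝ} (hX : MeasurableSet X) :
    MemLp (fun q => ((κ q).real X : ℂ)) ∞ (volume : Measure ℝ) := by
  refine memLp_top_of_bound (C := 1) ?_ (Filter.Eventually.of_forall fun q => ?_)
  · exact (Complex.measurable_ofReal.comp
      (Kernel.measurable_coe κ hX).ennreal_toReal).aestronglyMeasurable
  · rw [Complex.norm_real, Real.norm_of_nonneg measureReal_nonneg]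
    exact measureReal_le_one

/-- For a Markov kernel `κ` on `ℝ`, the observable `X ↦ ∫ κ(q, X) Q(dq)`, where `Q` is the spectral
measure of the position operator: `X` is sent to multiplication by `q ↦ κ(q, X)`. -/
def positionKernel (κ : Kernel ℝ ℝ) [IsMarkovKernel κ] : Observable ℝ L2R where
  effect X := mulOp fun q => ((κ q).real X : ℂ)
  isPositive X hX := by
    rw [ContinuousLinearMap.isPositive_iff_complex]
    intro ψ
    have h : ⟪mulOp (fun q => ((κ q).real X : ℂ)) ψ, ψ⟫_ℂ
        = ((∫ q, (κ q).real X * ‖ψ q‖ ^ 2 : ℝ) : ℂ) := by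
      rw [L2.inner_def, ← integral_complex_ofReal]
      refine integral_congr_ae ?_
      filter_upwards [mulOp_apply (memLp_kernel κ hX) ψ] with q hq
      rw [hq, RCLike.inner_apply', map_mul, Complex.conj_ofReal, mul_assoc, mul_comm _ (ψ q),
        Complex.mul_conj, Complex.normSq_eq_norm_sq]
      push_cast
      ring
    rw [h]
    refine ⟨by simp, ?_⟩
    rw [RCLike.re_eq_complex_re, Complex.ofReal_re]
    exact integral_nonneg fun q => by positivity
  effect_univ := by
    refine ContinuousLinearMap.ext fun ψ => Lp.ext ?_
    filter_upwards [mulOp_apply (memLp_kernel κ MeasurableSet.univ) ψ] with q hq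
    rw [hq]
    simp
  hasSum_effect X hX hd φ ψ := by
    have hin : ∀ Y : Set ℝ, MeasurableSet Y → ⟪φ, mulOp (fun q => ((κ q).real Y : ℂ)) ψ⟫_ℂ
        = ∫ q, ((κ q).real Y : ℂ) * ⟪φ q, ψ q⟫_ℂ := fun Y hY => by
      rw [L2.inner_def]
      refine integral_congr_ae ?_
      filter_upwards [mulOp_apply (memLp_kernel κ hY) ψ] with q hq
      rw [hq, ← smul_eq_mul, inner_smul_right]
    have hint : Integrable (fun q => ⟪φ q, ψ q⟫_ℂ) := L2.integrable_inner φ ψ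
    have hsum : ∀ q, HasSum (fun n => (κ q).real (X n)) ((κ q).real (⋃ n, X n)) := fun q => by
      have h := ENNReal.hasSum_toReal (f := fun n => κ q (X n))
        (by rw [← measure_iUnion hd hX]; finiteness)
      rwa [← ENNReal.tsum_toReal_eq (fun n => by finiteness), ← measure_iUnion hd hX] at h
    rw [hin _ (MeasurableSet.iUnion hX)]
    simp_rw [fun n => hin _ (hX n)]
    refine hasSum_integral_of_dominated_convergence
      (fun n q => (κ q).real (X n) * ‖⟪φ q, ψ q⟫_ℂ‖) (fun n => ?_) (fun n => ?_) ?_ ?_ ?_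
    · exact ((memLp_kernel κ (hX n)).1).mul hint.1
    · exact Filter.Eventually.of_forall fun q => by
        rw [norm_mul, Complex.norm_real, Real.norm_of_nonneg measureReal_nonneg]
    · exact Filter.Eventually.of_forall fun q => (hsum q).summable.mul_right _
    · simp_rw [tsum_mul_right, fun q => (hsum q).tsum_eq]
      refine hint.norm.bdd_mul (c := 1) ?_ ?_
      · exact (Kernel.measurable_coe κ (MeasurableSet.iUnion hX)).ennreal_toReal.aestronglyMeasurable
      · exact Filter.Eventually.of_forall fun q => by
          rw [Real.norm_of_nonneg measureReal_nonneg]; exact measureReal_le_one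
    · exact Filter.Eventually.of_forall fun q =>
        ((Complex.hasSum_ofReal).2 (hsum q)).mul_right _

/-- For a probability measure `μ` and measurable `g`, the kernel `(x, X) ↦ μ (X - g x)`. -/
def translateKernel (g : ℝ → ℝ) (hg : Measurable g) (μ : Measure ℝ) [IsProbabilityMeasure μ] :
    Kernel ℝ ℝ where
  toFun x := μ.map fun y => g x + y
  measurable' := by
    refine Measure.measurable_of_measurable_coe _ fun X hX => ?_
    have h : ∀ x, μ.map (fun y => g x + y) X = μ (Prod.mk x ⁻¹' {z | g z.1 + z.2 ∈ X}) :=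
      fun x => Measure.map_apply (by fun_prop) hX
    simp_rw [h]
    exact measurable_measure_prodMk_left (by measurability)

instance (g : ℝ → ℝ) (hg : Measurable g) (μ : Measure ℝ) [IsProbabilityMeasure μ] :
    IsMarkovKernel (translateKernel g hg μ) :=
  ⟨fun x => Measure.isProbabilityMeasure_map (by fun_prop)⟩

/-- The spectral measure `Q` of the position operator: `Q(X)` is multiplication by the indicator
function of `X`. -/
def position : Observable ℝ L2R := positionKernel Kernel.id

/-- The smeared position observable `X ↦ ∫ μ(X - q) Q(dq)`. -/
def smearedPosition (μ : Measure ℝ) [IsProbabilityMeasure μ] : Observable ℝ L2R :=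
  positionKernel (translateKernel (fun q => q) measurable_id μ)

/-- For a Markov kernel `κ` on `ℝ`, the observable `Y ↦ ∫ κ(p, Y) P(dp)`, where `P` is the spectral
measure of `P = -iħ d/dx`. The unitary Fourier transform `𝓕 φ(ξ) = ∫ exp(-2πixξ) φ(x) dx` turns `P`
into multiplication by `2πħξ`. -/
def momentumKernel (ħ : ℝ) (κ : Kernel ℝ ℝ) [IsMarkovKernel κ] : Observable ℝ L2R :=
  (positionKernel (κ.comap (fun ξ => 2 * Real.pi * ħ * ξ) (by fun_prop))).conj
    (Lp.fourierTransformₗᵢ ℝ ℂ)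

/-- The spectral measure of the momentum operator `P = -iħ d/dx`. -/
def momentum (ħ : ℝ) : Observable ℝ L2R := momentumKernel ħ Kernel.id

/-- The smeared momentum observable `Y ↦ ∫ ν(Y - p) P(dp)`. -/
def smearedMomentum (ħ : ℝ) (ν : Measure ℝ) [IsProbabilityMeasure ν] : Observable ℝ L2R :=
  momentumKernel ħ (translateKernel (fun p => p) measurable_id ν)

/-! ### Covariant phase space observables -/

/-- The translation `exp(-iqP/ħ)`, that is `(T ψ)(x) = ψ(x - q)`. -/
def translation (q : ℝ) : L2R →L[ℂ] L2R :=
  (Lp.compMeasurePreservingₗᵢ ℂ (fun x : ℝ => x - q)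
    (measurePreserving_sub_right volume q)).toContinuousLinearMap

/-- The Weyl operator `W(q,p) = exp(iqp/2ħ) exp(-iqP/ħ) exp(ipQ/ħ)`. -/
def weyl (ħ q p : ℝ) : L2R →L[ℂ] L2R :=
  Complex.exp (Complex.I * q * p / (2 * ħ)) •
    (translation q ∘L mulOp fun x => Complex.exp (Complex.I * p * x / ħ))

/-- The covariant phase space observable
`Z ↦ (2πħ)⁻¹ ∫_Z W(q,p) τ W(q,p)* dq dp` (weak integral). -/
def covariantObservable (ħ : ℝ) (τ : DensityOperator L2R) (Z : Set (ℝ × ℝ)) : L2R →L[ℂ] L2R :=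
  (1 / (2 * Real.pi * ħ) : ℂ) • weakIntegral (volume.restrict Z)
    fun z => weyl ħ z.1 z.2 ∘L τ.op ∘L (weyl ħ z.1 z.2).adjoint

/-- The parity operator `(Π ψ)(x) = ψ(-x)`. -/
def parity : L2R →ₗᵢ[ℂ] L2R :=
  Lp.compMeasurePreservingₗᵢ ℂ (fun x : ℝ => -x) (Measure.measurePreserving_neg volume)

/-- The distribution of `Q` in the state `Π τ Π*`. -/
def positionNoise (τ : DensityOperator L2R) : Measure ℝ :=
  (τ.conj parity).bornMeasure position

/-- The distribution of `P` in the state `Π τ Π*`. -/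
def momentumNoise (ħ : ℝ) (τ : DensityOperator L2R) : Measure ℝ :=
  (τ.conj parity).bornMeasure (momentum ħ)

instance (τ : DensityOperator L2R) : IsProbabilityMeasure (positionNoise τ) :=
  inferInstanceAs (IsProbabilityMeasure ((τ.conj parity).bornMeasure position))

instance (ħ : ℝ) (τ : DensityOperator L2R) : IsProbabilityMeasure (momentumNoise ħ τ) :=
  inferInstanceAs (IsProbabilityMeasure ((τ.conj parity).bornMeasure (momentum ħ)))

/-- Uffink's constant. -/
def uffinkK (ε₁ ε₂ : ℝ) : ℝ := (√((1 - ε₁) * (1 - ε₂)) - √(ε₁ * ε₂)) ^ 2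

end PhaseSpace

end

open PhaseSpace

/-! For fixed `q`, the matrix element `⟨φ, W(q,p) f⟩` is, up to a phase, the Fourier transform of `x
↦ conj (φ x) * f (x - q)` at frequency `-p/(2πħ)`. Plancherel in `p` therefore gives `∫ |⟨φ, W(q,p)
f⟩|² dp = 2πħ ∫ |φ(x)|² |f(x - q)|² dx`. Integrating over `q ∈ X` and summing over the vectors `f =
τ^{1/2} eᵢ` produces the quadratic form of the smeared position observable, because the position
density of `ΠτΠ*` is `y ↦ ∑ |f(-y)|²`. Conjugation by the Fourier transform exchanges the roles of
`q` and `p` and gives the other marginal.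

The error bar estimates use only one consequence: the outcome distribution of a smeared observable
is the sharp one convolved with the noise. Bounded noise on well localised inputs makes the gross
widths finite (`grossErrorBarWidth_ne_top`). A convolution is nowhere more concentrated than the
noise is on its best interval (`conv_interval_le`), so the bias-free width is at least the overall
width of the noise (`overallWidth_le_biasFreeErrorBarWidth`).

Both noise distributions belong to the single state `ΠτΠ*`. The lower bound is thus Uffink's
preparation uncertainty relation for that state (`uffinkK_le_overallWidth_mul`). It combines the
Landau–Pollak angle inequality, extended to mixtures through an `ℓ²` sum of copies of the space,
with the Hilbert–Schmidt estimate `‖P(J₂) Q(J₁)‖² ≤ |J₁| |J₂| / (2πħ)`. -/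

noncomputable section

namespace PhaseSpace

open scoped FourierTransform

/-! ### The Fourier transform on `L¹ ∩ L²` -/

/-- The Fourier transform on `L²(ℝ)`. -/
abbrev fourierL2 : L2R ≃ₗᵢ[ℂ] L2R := Lp.fourierTransformₗᵢ ℝ ℂ

theorem continuous_fourier {f : ℝ → ℂ} (hf : Integrable f) : Continuous (𝓕 f) :=
  VectorFourier.fourierIntegral_continuous Real.continuous_fourierChar
    (by exact continuous_inner) hf

open scoped ContDiff in
/-- The `L²` Fourier transform of an integrable function is its Fourier integral. -/
theorem fourierL2_toLp {f : ℝ → ℂ} (hf : Integrable f) (hf2 : MemLp f 2) :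
    fourierL2 (hf2.toLp f) =ᵐ[volume] 𝓕 f := by
  -- The `L²` transform is accessible as a tempered distribution: paired with a test function, the
  -- transform moves to that function, and the exchange formula for integrable functions moves it
  -- back onto `f`.
  refine ae_eq_of_integral_contDiff_smul_eq
    ((Lp.memLp _).locallyIntegrable (by norm_num)) (continuous_fourier hf).locallyIntegrable ?_
  intro g hg hgc
  have hgc' : HasCompactSupport (fun x => (g x : ℂ)) := hgc.comp_left (g := ((↑) : ℝ → ℂ)) rfl
  have hg' : ContDiff ℝ ∞ (fun x => (g x : ℂ)) := Complex.ofRealCLM.contDiff.comp hg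
  set G : SchwartzMap ℝ ℂ := hgc'.toSchwartzMap hg' with hG
  have h1 := congrArg (fun T => T G) (Lp.fourier_toTemperedDistribution_eq (hf2.toLp f))
  simp only [TemperedDistribution.fourier_apply, Lp.toTemperedDistribution_apply] at h1
  have h2 : ∫ x, (𝓕 G) x • (hf2.toLp f) x = ∫ x, (𝓕 G) x • f x :=
    integral_congr_ae (by filter_upwards [hf2.coeFn_toLp] with x hx; rw [hx])
  have h3 : ∫ x, (𝓕 G) x • f x = ∫ x, G x • 𝓕 f x := by
    have := VectorFourier.integral_fourierIntegral_smul_eq_flip (L := innerₗ ℝ)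
      Real.continuous_fourierChar (by exact continuous_inner) (G.integrable (μ := volume)) hf
    rw [flip_innerₗ] at this
    exact this
  rw [h2, h3] at h1
  exact h1.symm

theorem lintegral_enorm_sq (u : L2R) : ∫⁻ x, ‖u x‖ₑ ^ 2 = ‖u‖ₑ ^ 2 := by
  have h := Lp.enorm_def u
  rw [h, eLpNorm_eq_lintegral_rpow_enorm_toReal (by norm_num) (by norm_num)]
  rw [← ENNReal.rpow_natCast, ← ENNReal.rpow_mul]
  norm_num

theorem lintegral_enorm_fourier_sq {f : ℝ → ℂ} (hf : Integrable f) (hf2 : MemLp f 2) :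
    ∫⁻ ξ, ‖𝓕 f ξ‖ₑ ^ 2 = ∫⁻ x, ‖f x‖ₑ ^ 2 := by
  have h1 : ∫⁻ ξ, ‖𝓕 f ξ‖ₑ ^ 2 = ∫⁻ ξ, ‖fourierL2 (hf2.toLp f) ξ‖ₑ ^ 2 :=
    lintegral_congr_ae (by filter_upwards [fourierL2_toLp hf hf2] with x hx; rw [hx])
  have h2 : ∫⁻ x, ‖f x‖ₑ ^ 2 = ∫⁻ x, ‖hf2.toLp f x‖ₑ ^ 2 :=
    lintegral_congr_ae (by filter_upwards [hf2.coeFn_toLp] with x hx; rw [hx])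
  rw [h1, h2, lintegral_enorm_sq, lintegral_enorm_sq, ← ofReal_norm, ← ofReal_norm,
    LinearIsometryEquiv.norm_map]

/-- Continuous maps on `L²(ℝ)` that agree on integrable functions are equal. -/
theorem eq_of_forall_integrable {S T : L2R → L2R} (hS : Continuous S) (hT : Continuous T)
    (h : ∀ (f : ℝ → ℂ) (hf2 : MemLp f 2), Integrable f → S (hf2.toLp f) = T (hf2.toLp f)) :
    S = T := by
  refine (SchwartzMap.denseRange_toLpCLM (E := ℝ) (F := ℂ) (p := 2) (μ := volume)
    (by norm_num)).equalizer hS hT ?_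
  funext g
  exact h g (g.memLp 2) g.integrable

/-! ### Translation, parity and Weyl operators, and their Fourier transforms. -/

theorem translation_apply (q : ℝ) (u : L2R) : translation q u =ᵐ[volume] fun x => u (x - q) :=
  Lp.coeFn_compMeasurePreserving u (measurePreserving_sub_right volume q)

theorem parity_apply (u : L2R) : parity u =ᵐ[volume] fun x => u (-x) :=
  Lp.coeFn_compMeasurePreserving u (Measure.measurePreserving_neg volume)

theorem memLp_exp (a : ℝ → ℝ) (ha : Measurable a) :
    MemLp (fun x => Complex.exp (Complex.I * a x)) ∞ (volume : Measure ℝ) := by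
  refine memLp_top_of_bound (C := 1) (by fun_prop) (Filter.Eventually.of_forall fun x => ?_)
  rw [mul_comm, Complex.norm_exp_ofReal_mul_I]

theorem ae_comp_sub {P : ℝ → Prop} (q : ℝ) (h : ∀ᵐ x, P x) : ∀ᵐ x, P (x - q) :=
  (measurePreserving_sub_right volume q).quasiMeasurePreserving.ae h

theorem weyl_apply (ħ q p : ℝ) (u : L2R) : weyl ħ q p u =ᵐ[volume] fun x =>
    Complex.exp (Complex.I * (q * p / (2 * ħ) : ℝ)) *
      (Complex.exp (Complex.I * (p * (x - q) / ħ : ℝ)) * u (x - q)) := by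
  have hm : (fun x : ℝ => Complex.exp (Complex.I * p * x / ħ))
      = fun x : ℝ => Complex.exp (Complex.I * (p * x / ħ : ℝ)) := by
    funext x; congr 1; push_cast; ring
  have h1 := mulOp_apply (memLp_exp (fun x => p * x / ħ) (by fun_prop)) u
  have h2 := translation_apply q (mulOp (fun x => Complex.exp (Complex.I * p * x / ħ)) u)
  have h3 : weyl ħ q p u = Complex.exp (Complex.I * q * p / (2 * ħ)) •
    translation q (mulOp (fun x => Complex.exp (Complex.I * p * x / ħ)) u) := rfl
  rw [h3]
  filter_upwards [h2, ae_comp_sub q h1, Lp.coeFn_smul (Complex.exp (Complex.I * q * p / (2 * ħ)))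
    (translation q (mulOp (fun x => Complex.exp (Complex.I * p * x / ħ)) u))] with x h2 h1 h4
  rw [h4, Pi.smul_apply, h2, hm, h1, smul_eq_mul]
  congr 2
  push_cast; ring

/-- This lets the parity in the momentum noise be treated as a reflection of the frequency variable.
-/
theorem fourierL2_parity (u : L2R) : fourierL2 (parity u) = parity (fourierL2 u) := by
  refine congrFun (eq_of_forall_integrable (S := fun u => fourierL2 (parity u))
    (T := fun u => parity (fourierL2 u)) (fourierL2.continuous.comp parity.continuous)
    (parity.continuous.comp fourierL2.continuous) fun f hf2 hf => ?_) u
  have hf2' : MemLp (fun x => f (-x)) 2 :=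
    hf2.comp_measurePreserving (Measure.measurePreserving_neg volume)
  have h1 : parity (hf2.toLp f) = hf2'.toLp _ := rfl
  refine Lp.ext ?_
  simp only [h1]
  have h2 := (Measure.measurePreserving_neg (volume : Measure ℝ)).quasiMeasurePreserving.ae
    (fourierL2_toLp hf hf2)
  filter_upwards [fourierL2_toLp hf.comp_neg hf2', h2, parity_apply (fourierL2 (hf2.toLp f))]
    with x h3 h4 h5
  rw [h3, h5, h4]
  exact Real.fourier_comp_linearIsometry (LinearIsometryEquiv.neg ℝ) f x

theorem fourier_exp_mul_comp_sub (f : ℝ → ℂ) (a q ξ : ℝ) :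
    𝓕 (fun x => Complex.exp (Complex.I * (2 * Real.pi * a * (x - q) : ℝ)) * f (x - q)) ξ =
      Complex.exp (Complex.I * (-(2 * Real.pi * q * ξ) : ℝ)) * 𝓕 f (ξ - a) := by
  simp only [Real.fourier_real_eq_integral_exp_smul, smul_eq_mul]
  rw [← integral_const_mul, ← integral_sub_right_eq_self
    (fun x => Complex.exp (Complex.I * (-(2 * Real.pi * q * ξ) : ℝ)) *
      (Complex.exp ((-2 * Real.pi * x * (ξ - a) : ℝ) * Complex.I) * f x)) q]
  refine integral_congr_ae (Filter.Eventually.of_forall fun x => ?_)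
  simp only [← mul_assoc, ← Complex.exp_add]
  congr 2
  push_cast
  ring

/-- The Fourier transform exchanges translation and modulation: the shift by `q` becomes a phase and
the boost by `p` a shift by `p / (2πħ)`. The computation is done for integrable functions and
extended by density. -/
theorem fourierL2_weyl (ħ q p : ℝ) (u : L2R) :
    fourierL2 (weyl ħ q p u) =ᵐ[volume] fun ξ =>
      Complex.exp (Complex.I * (q * p / (2 * ħ) : ℝ)) *
        (Complex.exp (Complex.I * (-(2 * Real.pi * q * ξ) : ℝ)) *
          fourierL2 u (ξ - p / (2 * Real.pi * ħ))) := by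
  set c := Complex.exp (Complex.I * (q * p / (2 * ħ) : ℝ))
  set a := p / (2 * Real.pi * ħ)
  set m : ℝ → ℂ := fun ξ => Complex.exp (Complex.I * (-(2 * Real.pi * q * ξ) : ℝ)) with hm
  have hmm : MemLp m ∞ (volume : Measure ℝ) := memLp_exp _ (by fun_prop)
  have key : ∀ v : L2R, c • mulOp m (translation a v) =ᵐ[volume]
      fun ξ => c * (m ξ * v (ξ - a)) := fun v => by
    filter_upwards [Lp.coeFn_smul c (mulOp m (translation a v)),
      mulOp_apply hmm (translation a v), translation_apply a v] with x h1 h2 h3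
    rw [h1, Pi.smul_apply, h2, h3, smul_eq_mul]
  have : (fun u => fourierL2 (weyl ħ q p u))
      = fun u => c • mulOp m (translation a (fourierL2 u)) := by
    refine eq_of_forall_integrable (fourierL2.continuous.comp (weyl ħ q p).continuous)
      (((mulOp m).continuous.comp ((translation a).continuous.comp
        fourierL2.continuous)).const_smul c) fun f hf2 hf => Lp.ext ?_
    set g : ℝ → ℂ := fun x =>
      c * (Complex.exp (Complex.I * (2 * Real.pi * a * (x - q) : ℝ)) * f (x - q)) with hg
    have hgw : weyl ħ q p (hf2.toLp f) =ᵐ[volume] g := by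
      filter_upwards [weyl_apply ħ q p (hf2.toLp f), ae_comp_sub q hf2.coeFn_toLp] with x h1 h2
      rw [h1, h2, hg]
      congr 4
      simp only [a]
      field_simp
    have hg2 : MemLp g 2 := (Lp.memLp _).ae_eq hgw
    have hg1 : Integrable g := by
      have h := hf.comp_sub_right q
      refine (h.bdd_mul (c := 1) (f := fun x =>
        Complex.exp (Complex.I * (2 * Real.pi * a * (x - q) : ℝ)))
        (by fun_prop) (Filter.Eventually.of_forall fun x => ?_)).const_mul c
      rw [mul_comm, Complex.norm_exp_ofReal_mul_I]
    have hgw' : weyl ħ q p (hf2.toLp f) = hg2.toLp g :=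
      Lp.ext (hgw.trans hg2.coeFn_toLp.symm)
    rw [hgw']
    filter_upwards [fourierL2_toLp hg1 hg2, key (fourierL2 (hf2.toLp f)),
      ae_comp_sub a (fourierL2_toLp hf hf2)] with ξ h1 h2 h3
    rw [h1, h2, h3, hm, ← fourier_exp_mul_comp_sub, hg]
    simp only [Real.fourier_real_eq_integral_exp_smul, smul_eq_mul]
    rw [← integral_const_mul]
    refine integral_congr_ae (Filter.Eventually.of_forall fun x => ?_)
    ring
  rw [congrFun this u]
  exact key _

open scoped ComplexConjugate

/-! ### Square integrability of the matrix elements of the Weyl operators -/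

/-- The function `x ↦ conj (u x) * v (x - s)`. -/
def crossProduct (u v : L2R) (s x : ℝ) : ℂ := conj (u x) * v (x - s)

/-- Only absolute values enter the phase space integrals, so the Weyl phase and the phase coming
from the shifted exponential both drop out. -/
theorem enorm_inner_weyl (ħ q p : ℝ) (φ f : L2R) :
    ‖⟪φ, weyl ħ q p f⟫_ℂ‖ₑ = ‖𝓕 (crossProduct φ f q) (-(p / (2 * Real.pi * ħ)))‖ₑ := by
  have h : ⟪φ, weyl ħ q p f⟫_ℂ = Complex.exp ((q * p / (2 * ħ) - p * q / ħ : ℝ) * Complex.I) *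
      𝓕 (crossProduct φ f q) (-(p / (2 * Real.pi * ħ))) := by
    rw [L2.inner_def, Real.fourier_real_eq_integral_exp_smul, ← integral_const_mul]
    refine integral_congr_ae ?_
    filter_upwards [weyl_apply ħ q p f] with x hx
    rw [hx, RCLike.inner_apply', crossProduct, smul_eq_mul]
    have e : Complex.exp ((q * p / (2 * ħ) - p * q / ħ : ℝ) * Complex.I) *
        Complex.exp ((-2 * Real.pi * x * (-(p / (2 * Real.pi * ħ))) : ℝ) * Complex.I) =
        Complex.exp (Complex.I * (q * p / (2 * ħ) : ℝ)) *
          Complex.exp (Complex.I * (p * (x - q) / ħ : ℝ)) := by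
      have : -2 * Real.pi * x * (-(p / (2 * Real.pi * ħ))) = p * x / ħ := by
        field_simp
      rw [this, ← Complex.exp_add, ← Complex.exp_add]
      congr 1
      push_cast
      ring
    rw [← mul_assoc (Complex.exp _) (Complex.exp _), ← mul_assoc (Complex.exp _) (Complex.exp _), e]
    ring
  rw [h, enorm_mul, ← ofReal_norm, Complex.norm_exp_ofReal_mul_I]
  simp

/-- In the Fourier picture the shift is governed by `p` and the frequency is `q`, so Plancherel now
integrates out `q`, as sets of the form `univ ×ˢ Y` require. -/
theorem enorm_inner_weyl_fourier (ħ q p : ℝ) (φ f : L2R) :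
    ‖⟪φ, weyl ħ q p f⟫_ℂ‖ₑ =
      ‖𝓕 (crossProduct (fourierL2 φ) (fourierL2 f) (p / (2 * Real.pi * ħ))) q‖ₑ := by
  have h : ⟪φ, weyl ħ q p f⟫_ℂ = Complex.exp ((q * p / (2 * ħ) : ℝ) * Complex.I) *
      𝓕 (crossProduct (fourierL2 φ) (fourierL2 f) (p / (2 * Real.pi * ħ))) q := by
    rw [← fourierL2.inner_map_map, L2.inner_def, Real.fourier_real_eq_integral_exp_smul,
      ← integral_const_mul]
    refine integral_congr_ae ?_
    filter_upwards [fourierL2_weyl ħ q p f] with x hx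
    rw [hx, RCLike.inner_apply', crossProduct, smul_eq_mul, mul_comm Complex.I,
      mul_comm Complex.I]
    have : -(2 * Real.pi * q * x) = -2 * Real.pi * x * q := by ring
    rw [this]
    ring
  rw [h, enorm_mul, ← ofReal_norm, Complex.norm_exp_ofReal_mul_I]
  simp

theorem measurable_enorm_fourier_crossProduct (u v : L2R) :
    Measurable fun z : ℝ × ℝ => ‖𝓕 (crossProduct u v z.1) z.2‖ₑ := by
  have hu := (Lp.stronglyMeasurable u).measurable
  have hv := (Lp.stronglyMeasurable v).measurable
  have h : StronglyMeasurable fun z : ℝ × ℝ =>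
      ∫ x, Complex.exp ((-2 * Real.pi * x * z.2 : ℝ) * Complex.I) *
        (conj (u x) * v (x - z.1)) := by
    refine StronglyMeasurable.integral_prod_right (ν := volume) (f := fun z : ℝ × ℝ => fun x =>
      Complex.exp ((-2 * Real.pi * x * z.2 : ℝ) * Complex.I) * (conj (u x) * v (x - z.1))) ?_
    refine Measurable.stronglyMeasurable ?_
    have h1 : Measurable fun w : (ℝ × ℝ) × ℝ => conj (u w.2) :=
      Complex.continuous_conj.measurable.comp (hu.comp measurable_snd)
    have h2 : Measurable fun w : (ℝ × ℝ) × ℝ => v (w.2 - w.1.1) := hv.comp (by fun_prop)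
    exact Measurable.mul (by fun_prop) (h1.mul h2)
  have h2 := h.measurable.enorm
  convert h2 using 3 with z
  exact Real.fourier_real_eq_integral_exp_smul _ _

theorem integrable_crossProduct (u v : L2R) (s : ℝ) : Integrable (crossProduct u v s) := by
  have h := L2.integrable_inner (𝕜 := ℂ) u (translation s v)
  refine h.congr ?_
  filter_upwards [translation_apply s v] with x hx
  rw [hx, RCLike.inner_apply', crossProduct]

theorem enorm_crossProduct (u v : L2R) (s x : ℝ) :
    ‖crossProduct u v s x‖ₑ = ‖u x‖ₑ * ‖v (x - s)‖ₑ := by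
  rw [crossProduct, enorm_mul, ← ofReal_norm (conj (u x)), RCLike.norm_conj, ofReal_norm]

theorem lintegral_lintegral_crossProduct (u v : L2R) (X : Set ℝ) :
    ∫⁻ s in X, ∫⁻ x, ‖crossProduct u v s x‖ₑ ^ 2 =
      ∫⁻ x, ‖u x‖ₑ ^ 2 * ∫⁻ s in X, ‖v (x - s)‖ₑ ^ 2 := by
  have hu := (Lp.stronglyMeasurable u).measurable
  have hv := (Lp.stronglyMeasurable v).measurable
  simp_rw [enorm_crossProduct, mul_pow]
  rw [lintegral_lintegral_swap]
  · refine lintegral_congr fun x => ?_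
    rw [lintegral_const_mul]
    exact ((hv.comp (by fun_prop)).enorm.pow_const 2)
  · have h1 : Measurable fun z : ℝ × ℝ => ‖u z.2‖ₑ ^ 2 :=
      ((hu.comp measurable_snd).enorm.pow_const 2)
    have h2 : Measurable fun z : ℝ × ℝ => ‖v (z.2 - z.1)‖ₑ ^ 2 :=
      ((hv.comp (by fun_prop : Measurable fun z : ℝ × ℝ => z.2 - z.1)).enorm.pow_const 2)
    exact (h1.mul h2).aemeasurable

/-- By Tonelli the value is `‖u‖² ‖v‖²`. For an individual `s` the product of two `L²` functions is
only known to be integrable; finiteness here puts it in `L²` for almost every `s`, where Plancherel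
applies. -/
theorem lintegral_crossProduct_lt_top (u v : L2R) :
    ∫⁻ s, ∫⁻ x, ‖crossProduct u v s x‖ₑ ^ 2 < ∞ := by
  have h := lintegral_lintegral_crossProduct u v Set.univ
  simp only [Measure.restrict_univ] at h
  rw [h]
  have h2 : ∀ x, ∫⁻ s, ‖v (x - s)‖ₑ ^ 2 = ‖v‖ₑ ^ 2 := fun x => by
    rw [lintegral_sub_left_eq_self (fun y => ‖v y‖ₑ ^ 2) x, lintegral_enorm_sq]
  simp_rw [h2]
  rw [lintegral_mul_const _ ((Lp.stronglyMeasurable u).measurable.enorm.pow_const 2),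
    lintegral_enorm_sq]
  finiteness

theorem memLp_two_of_lintegral_lt_top {f : ℝ → ℂ} (hf : AEStronglyMeasurable f volume)
    (h : ∫⁻ x, ‖f x‖ₑ ^ 2 < ∞) : MemLp f 2 := by
  refine ⟨hf, ?_⟩
  rw [eLpNorm_lt_top_iff_lintegral_rpow_enorm_lt_top (by norm_num) (by norm_num)]
  have e : (2 : ℝ≥0∞).toReal = (2 : ℕ) := by norm_num
  simpa only [e, ENNReal.rpow_natCast] using h

/-- Plancherel's theorem for the cross products. -/
theorem lintegral_lintegral_fourier_crossProduct (u v : L2R) (X : Set ℝ) :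
    ∫⁻ s in X, ∫⁻ t, ‖𝓕 (crossProduct u v s) t‖ₑ ^ 2 =
      ∫⁻ x, ‖u x‖ₑ ^ 2 * ∫⁻ s in X, ‖v (x - s)‖ₑ ^ 2 := by
  rw [← lintegral_lintegral_crossProduct]
  refine lintegral_congr_ae (ae_restrict_of_ae ?_)
  have hu := (Lp.stronglyMeasurable u).measurable
  have hv := (Lp.stronglyMeasurable v).measurable
  have hm : Measurable fun z : ℝ × ℝ => ‖crossProduct u v z.1 z.2‖ₑ ^ 2 := by
    simp_rw [enorm_crossProduct]
    exact ((hu.comp measurable_snd).enorm.mul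
      (hv.comp (by fun_prop : Measurable fun z : ℝ × ℝ => z.2 - z.1)).enorm).pow_const 2
  filter_upwards [ae_lt_top hm.lintegral_prod_right' (lintegral_crossProduct_lt_top u v).ne]
    with s hs
  exact lintegral_enorm_fourier_sq (integrable_crossProduct u v s)
    (memLp_two_of_lintegral_lt_top (integrable_crossProduct u v s).1 hs)

/-! ### Rescaling the frequency variable, the source of the factor `2πħ`. -/

theorem lintegral_comp_mul_left (g : ℝ → ℝ≥0∞) (hg : Measurable g) {a : ℝ} (ha : a ≠ 0) :
    ENNReal.ofReal |a| * ∫⁻ x, g (a * x) = ∫⁻ x, g x := by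
  rw [← lintegral_map hg (by fun_prop), Real.map_volume_mul_left ha, lintegral_smul_measure,
    smul_eq_mul, ← mul_assoc, ← ENNReal.ofReal_mul (abs_nonneg a), ← abs_mul, mul_inv_cancel₀ ha]
  simp

theorem lintegral_prod_univ_comp_neg_div {g : ℝ × ℝ → ℝ≥0∞} (hg : Measurable g) {c : ℝ}
    (hc : 0 < c) (X : Set ℝ) :
    ∫⁻ z in X ×ˢ Set.univ, g (z.1, -(z.2 / c)) =
      ENNReal.ofReal c * ∫⁻ s in X, ∫⁻ t, g (s, t) := by
  have hm : Measurable fun z : ℝ × ℝ => g (z.1, -(z.2 / c)) := hg.comp (by fun_prop)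
  rw [Measure.volume_eq_prod, ← Measure.prod_restrict, Measure.restrict_univ,
    lintegral_prod _ hm.aemeasurable, ← lintegral_const_mul _ hg.lintegral_prod_right']
  refine lintegral_congr fun s => ?_
  have h := lintegral_comp_mul_left (fun p => g (s, -(p / c)))
    (hm.comp (measurable_prodMk_left (x := s))) (a := -c) (by simp [hc.ne'])
  rw [← h, abs_neg, abs_of_pos hc]
  congr 1
  refine lintegral_congr fun t => ?_
  congr 2
  field_simp

theorem lintegral_univ_prod_comp_div {g : ℝ × ℝ → ℝ≥0∞} (hg : Measurable g) {c : ℝ}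
    (hc : 0 < c) {Y : Set ℝ} (hY : MeasurableSet Y) :
    ∫⁻ z in Set.univ ×ˢ Y, g (z.2 / c, z.1) =
      ENNReal.ofReal c * ∫⁻ s in (fun s => c * s) ⁻¹' Y, ∫⁻ t, g (s, t) := by
  have hm : Measurable fun z : ℝ × ℝ => g (z.2 / c, z.1) := hg.comp (by fun_prop)
  have hcm : Measurable fun s : ℝ => c * s := by fun_prop
  have hi : Measurable fun p => ∫⁻ q, g (p / c, q) := hm.lintegral_prod_left'
  rw [Measure.volume_eq_prod, ← Measure.prod_restrict, Measure.restrict_univ,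
    lintegral_prod_symm _ hm.aemeasurable, ← lintegral_indicator hY, ← lintegral_indicator (hcm hY),
    ← lintegral_comp_mul_left _ (hi.indicator hY) hc.ne', abs_of_pos hc]
  congr 1
  refine lintegral_congr fun s => ?_
  have e : c * s / c = s := by field_simp
  classical
  simp only [Set.indicator_apply, Set.mem_preimage, e]

theorem lintegral_weyl_prod_univ {ħ : ℝ} (hħ : 0 < ħ) (φ f : L2R) (X : Set ℝ) :
    ∫⁻ z in X ×ˢ Set.univ, ‖⟪φ, weyl ħ z.1 z.2 f⟫_ℂ‖ₑ ^ 2 =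
      ENNReal.ofReal (2 * Real.pi * ħ) *
        ∫⁻ x, ‖φ x‖ₑ ^ 2 * ∫⁻ s in X, ‖f (x - s)‖ₑ ^ 2 := by
  simp_rw [enorm_inner_weyl]
  rw [← lintegral_lintegral_fourier_crossProduct]
  exact lintegral_prod_univ_comp_neg_div (g := fun z => ‖𝓕 (crossProduct φ f z.1) z.2‖ₑ ^ 2)
    ((measurable_enorm_fourier_crossProduct φ f).pow_const 2) (by positivity) X

theorem lintegral_weyl_univ_prod {ħ : ℝ} (hħ : 0 < ħ) (φ f : L2R) {Y : Set ℝ}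
    (hY : MeasurableSet Y) :
    ∫⁻ z in Set.univ ×ˢ Y, ‖⟪φ, weyl ħ z.1 z.2 f⟫_ℂ‖ₑ ^ 2 =
      ENNReal.ofReal (2 * Real.pi * ħ) *
        ∫⁻ ξ, ‖fourierL2 φ ξ‖ₑ ^ 2 *
          ∫⁻ s in (fun s => 2 * Real.pi * ħ * s) ⁻¹' Y, ‖fourierL2 f (ξ - s)‖ₑ ^ 2 := by
  simp_rw [enorm_inner_weyl_fourier]
  generalize fourierL2 φ = u, fourierL2 f = v
  rw [← lintegral_lintegral_fourier_crossProduct]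
  exact lintegral_univ_prod_comp_div (g := fun z => ‖𝓕 (crossProduct u v z.1) z.2‖ₑ ^ 2)
    ((measurable_enorm_fourier_crossProduct u v).pow_const 2) (by positivity) hY

theorem measurable_enorm_inner_weyl (ħ : ℝ) (φ f : L2R) :
    Measurable fun z : ℝ × ℝ => ‖⟪φ, weyl ħ z.1 z.2 f⟫_ℂ‖ₑ := by
  simp_rw [enorm_inner_weyl]
  have h : Measurable fun z : ℝ × ℝ => (z.1, -(z.2 / (2 * Real.pi * ħ))) := by fun_prop
  have h2 := (measurable_enorm_fourier_crossProduct φ f).comp h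
  exact h2

/-! ### Traces, Born probabilities and weak integrals -/

theorem inner_polarization {H : Type*} [NormedAddCommGroup H] [InnerProductSpace ℂ H]
    (A : H →L[ℂ] H) (φ ψ : H) :
    ⟪φ, A ψ⟫_ℂ = (⟪φ + ψ, A (φ + ψ)⟫_ℂ - ⟪φ - ψ, A (φ - ψ)⟫_ℂ
      - Complex.I * ⟪φ + Complex.I • ψ, A (φ + Complex.I • ψ)⟫_ℂ
      + Complex.I * ⟪φ - Complex.I • ψ, A (φ - Complex.I • ψ)⟫_ℂ) / 4 := by
  simp only [map_add, map_sub, inner_add_left, inner_add_right, map_smul, inner_smul_left,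
    inner_smul_right, Complex.conj_I, inner_sub_left, inner_sub_right]
  linear_combination (1 / 2 * ⟪φ, A ψ⟫_ℂ - 1 / 2 * ⟪ψ, A φ⟫_ℂ) * Complex.I_sq

theorem inner_symm_apply {H : Type*} [NormedAddCommGroup H] [InnerProductSpace ℂ H]
    (U : H ≃ₗᵢ[ℂ] H) (x y : H) : ⟪x, U.symm y⟫_ℂ = ⟪U x, y⟫_ℂ := by
  rw [← U.inner_map_map x, U.apply_symm_apply]

/-- A weak integral is determined by its diagonal matrix elements. -/
theorem weakIntegral_eq {H : Type*} [NormedAddCommGroup H] [InnerProductSpace ℂ H]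
    {Ω : Type*} [MeasurableSpace Ω] {ν : Measure Ω} {f : Ω → H →L[ℂ] H}
    {T : H →L[ℂ] H} (h1 : ∀ φ, Integrable (fun x => ⟪φ, f x φ⟫_ℂ) ν)
    (h2 : ∀ φ, ⟪φ, T φ⟫_ℂ = ∫ x, ⟪φ, f x φ⟫_ℂ ∂ν) : weakIntegral ν f = T := by
  have key : ∀ φ ψ : H, Integrable (fun x => ⟪φ, f x ψ⟫_ℂ) ν ∧
      ⟪φ, T ψ⟫_ℂ = ∫ x, ⟪φ, f x ψ⟫_ℂ ∂ν := fun φ ψ => by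
    have i1 := h1 (φ + ψ)
    have i2 := h1 (φ - ψ)
    have i3 := (h1 (φ + Complex.I • ψ)).const_mul Complex.I
    have i4 := (h1 (φ - Complex.I • ψ)).const_mul Complex.I
    have i12 : Integrable (fun x => ⟪φ + ψ, f x (φ + ψ)⟫_ℂ - ⟪φ - ψ, f x (φ - ψ)⟫_ℂ) ν := i1.sub i2
    have i123 : Integrable (fun x => ⟪φ + ψ, f x (φ + ψ)⟫_ℂ - ⟪φ - ψ, f x (φ - ψ)⟫_ℂ
        - Complex.I * ⟪φ + Complex.I • ψ, f x (φ + Complex.I • ψ)⟫_ℂ) ν := i12.sub i3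
    constructor
    · refine ((i123.add i4).div_const 4).congr (Filter.Eventually.of_forall fun x => ?_)
      exact (inner_polarization (f x) φ ψ).symm
    · rw [integral_congr_ae (Filter.Eventually.of_forall fun x => inner_polarization (f x) φ ψ),
        integral_div, inner_polarization T φ ψ, h2, h2, h2, h2, ← integral_const_mul,
        ← integral_const_mul, ← integral_sub i1 i2, ← integral_sub i12 i3, ← integral_add i123 i4]
  have hex : ∃ T : H →L[ℂ] H, ∀ φ ψ : H, Integrable (fun x => ⟪φ, f x ψ⟫_ℂ) ν ∧
      ⟪φ, T ψ⟫_ℂ = ∫ x, ⟪φ, f x ψ⟫_ℂ ∂ν := ⟨T, key⟩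
  rw [weakIntegral, dif_pos hex]
  refine ContinuousLinearMap.ext fun ψ => ext_inner_left ℂ fun φ => ?_
  rw [(hex.choose_spec φ ψ).2, (key φ ψ).2]

section Abstract

variable {H : Type*} [NormedAddCommGroup H] [InnerProductSpace ℂ H] [CompleteSpace H]

theorem ofReal_re_inner_adjoint_comp_self (B : H →L[ℂ] H) (x : H) :
    ENNReal.ofReal (⟪x, B.adjoint (B x)⟫_ℂ).re = ‖B x‖ₑ ^ 2 := by
  rw [ContinuousLinearMap.adjoint_inner_right, inner_self_eq_norm_sq_to_K, ← ofReal_norm,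
    ← ENNReal.ofReal_pow (norm_nonneg _)]
  norm_cast

/-- `tr(V V* A) = tr(V* A V)` for positive `A`. -/
theorem DensityOperator.ofReal_re_trace_comp (ρ : DensityOperator H) {V : H →L[ℂ] H}
    (hV : ρ.op = V ∘L V.adjoint) {A : H →L[ℂ] H} (hA : A.IsPositive) :
    ENNReal.ofReal (trace (ρ.op ∘L A)).re =
      ∑' i, ENNReal.ofReal (⟪V (traceBasis H i), A (V (traceBasis H i))⟫_ℂ).re := by
  set e := traceBasis H
  obtain ⟨B, hB, hBA⟩ : ∃ B : H →L[ℂ] H, B.adjoint = B ∧ B ∘L B = A :=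
    ⟨CFC.sqrt A, ((ContinuousLinearMap.nonneg_iff_isPositive _).1
      (CFC.sqrt_nonneg A)).isSelfAdjoint.adjoint_eq,
      CFC.sqrt_mul_sqrt_self A ((ContinuousLinearMap.nonneg_iff_isPositive _).2 hA)⟩
  have hq : ∀ x, ENNReal.ofReal (⟪x, A x⟫_ℂ).re = ‖B x‖ₑ ^ 2 := fun x => by
    rw [← ofReal_re_inner_adjoint_comp_self, hB, ← hBA]; rfl
  have h := Complex.hasSum_re (ρ.hasSum_trace_comp A)
  rw [← h.tsum_eq]
  refine (ENNReal.ofReal_tsum_of_nonneg (fun i => hA.re_inner_nonneg_right _) h.summable).trans ?_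
  refine (tsum_congr fun i => hq (ρ.root (e i))).trans ?_
  simp_rw [hq]
  -- With `A = B²` both sums are Hilbert–Schmidt norms, of `B ρ^{1/2}` and of `B V`. Passing to
  -- adjoints, they depend only on `ρ^{1/2} ρ^{1/2}` and `V V*`, which coincide.
  have h1 := tsum_enorm_adjoint e e (B ∘L ρ.root)
  have h2 := tsum_enorm_adjoint e e (B ∘L V)
  rw [ContinuousLinearMap.adjoint_comp, hB] at h1 h2
  simp only [ContinuousLinearMap.comp_apply] at h1 h2
  rw [h1, h2]
  refine tsum_congr fun j => ?_
  have h3 := ofReal_re_inner_adjoint_comp_self ρ.root.adjoint (B (e j))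
  have h4 := ofReal_re_inner_adjoint_comp_self V.adjoint (B (e j))
  rw [← h3, ← h4, ContinuousLinearMap.adjoint_adjoint, ContinuousLinearMap.adjoint_adjoint,
    ρ.root_adjoint]
  have h5 : ρ.root (ρ.root (B (e j))) = V (V.adjoint (B (e j))) := by
    have h6 := ρ.root_comp_root
    rw [hV] at h6
    exact congrArg (fun T => T (B (e j))) h6
  rw [h5]

theorem DensityOperator.op_eq_root (ρ : DensityOperator H) :
    ρ.op = ρ.root ∘L ρ.root.adjoint := by
  rw [ρ.root_adjoint, ρ.root_comp_root]

/-- An arbitrary factor `V` is allowed because the convenient factor of `U ρ U*` is `U ρ^{1/2}`,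
which need not be its positive root. -/
theorem DensityOperator.bornMeasure_apply_of_eq (ρ : DensityOperator H) {V : H →L[ℂ] H}
    (hV : ρ.op = V ∘L V.adjoint) {Ω : Type*} [MeasurableSpace Ω] (E : Observable Ω H) {X : Set Ω}
    (hX : MeasurableSet X) :
    ρ.bornMeasure E X = ∑' i, ENNReal.ofReal
      (⟪V (traceBasis H i), E.effect X (V (traceBasis H i))⟫_ℂ).re := by
  rw [ρ.bornMeasure_apply E hX]
  exact ρ.ofReal_re_trace_comp hV (E.isPositive X hX)

theorem DensityOperator.conj_op_eq (ρ : DensityOperator H) (U : H →ₗᵢ[ℂ] H) {V : H →L[ℂ] H}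
    (hV : ρ.op = V ∘L V.adjoint) :
    (ρ.conj U).op = (U.toContinuousLinearMap ∘L V) ∘L (U.toContinuousLinearMap ∘L V).adjoint := by
  rw [ContinuousLinearMap.adjoint_comp]
  change U.toContinuousLinearMap ∘L ρ.op ∘L U.toContinuousLinearMap.adjoint = _
  rw [hV]
  rfl

/-- Measuring `U* E U` in the state `ρ` amounts to measuring `E` in the state `U ρ U*`. -/
theorem DensityOperator.bornMeasure_conj (ρ : DensityOperator H) {Ω : Type*} [MeasurableSpace Ω]
    (E : Observable Ω H) (U : H ≃ₗᵢ[ℂ] H) :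
    ρ.bornMeasure (E.conj U) = (ρ.conj U.toLinearIsometry).bornMeasure E := by
  ext X hX
  rw [ρ.bornMeasure_apply_of_eq ρ.op_eq_root _ hX,
    (ρ.conj U.toLinearIsometry).bornMeasure_apply_of_eq (ρ.conj_op_eq _ ρ.op_eq_root) _ hX]
  refine tsum_congr fun i => ?_
  congr 2
  exact inner_symm_apply U _ _

/-- The diagonal matrix elements of `U ρ U*`. -/
theorem DensityOperator.inner_conj_apply (ρ : DensityOperator H) (U : H →L[ℂ] H) (φ : H) :
    ⟪φ, (U ∘L ρ.op ∘L U.adjoint) φ⟫_ℂ =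
      ((∑' i, ‖⟪φ, U (ρ.root (traceBasis H i))⟫_ℂ‖ₑ ^ 2).toReal : ℂ) := by
  have h1 := (enorm_sq_eq_tsum (traceBasis H) (ρ.root (U.adjoint φ))).2
  have h2 : ∀ i, ⟪ρ.root (U.adjoint φ), traceBasis H i⟫_ℂ = ⟪φ, U (ρ.root (traceBasis H i))⟫_ℂ :=
    fun i => by
      rw [← ContinuousLinearMap.adjoint_inner_right, ρ.root_adjoint,
        ContinuousLinearMap.adjoint_inner_left]
  simp_rw [h2] at h1
  rw [← h1, ← ofReal_norm, ← ENNReal.ofReal_pow (norm_nonneg _),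
    ENNReal.toReal_ofReal (by positivity)]
  have h3 : (U ∘L ρ.op ∘L U.adjoint) φ = U (ρ.root (ρ.root (U.adjoint φ))) := by
    rw [← ρ.root_comp_root]; rfl
  rw [h3, ← ContinuousLinearMap.adjoint_inner_left, ← ContinuousLinearMap.adjoint_inner_left,
    ρ.root_adjoint, inner_self_eq_norm_sq_to_K]
  norm_cast

/-- Distinct basis vectors are at distance `√2`, so the balls of radius `1/2` around them are
disjoint. Countability is needed to exchange sums over the basis with integrals. -/
theorem countable_traceIndex [TopologicalSpace.SeparableSpace H] : Countable (traceIndex H) := by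
  refine Pairwise.countable_of_isOpen_disjoint
    (s := fun i => Metric.ball (traceBasis H i) (1 / 2)) (fun i j hij => ?_)
    (fun i => Metric.isOpen_ball) (fun i => ⟨_, Metric.mem_ball_self (by norm_num)⟩)
  refine Metric.ball_disjoint_ball ?_
  have ho := (traceBasis H).orthonormal
  have h : ‖traceBasis H i - traceBasis H j‖ ^ 2 = 2 := by
    rw [@norm_sub_sq ℂ, ho.1, ho.1, ho.2 hij]
    norm_num
  rw [dist_eq_norm]
  nlinarith [norm_nonneg (traceBasis H i - traceBasis H j)]

end Abstract

instance : Fact ((2 : ℝ≥0∞) ≠ ∞) := ⟨by norm_num⟩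

instance : Countable (traceIndex L2R) := countable_traceIndex

/-- The covariant observable is determined by its diagonal matrix elements. -/
theorem covariantObservable_eq {ħ : ℝ} (hħ : 0 < ħ) (τ : DensityOperator L2R) {Z : Set (ℝ × ℝ)}
    {T : L2R →L[ℂ] L2R} (hT : T.IsPositive)
    (h : ∀ φ, ∑' i, ∫⁻ z in Z, ‖⟪φ, weyl ħ z.1 z.2 (τ.root (traceBasis L2R i))⟫_ℂ‖ₑ ^ 2 =
      ENNReal.ofReal (2 * Real.pi * ħ) * ENNReal.ofReal (⟪φ, T φ⟫_ℂ).re) :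
    covariantObservable ħ τ Z = T := by
  set g : L2R → ℝ × ℝ → ℝ≥0∞ := fun φ z =>
    ∑' i, ‖⟪φ, weyl ħ z.1 z.2 (τ.root (traceBasis L2R i))⟫_ℂ‖ₑ ^ 2 with hg
  have hgm : ∀ φ, Measurable (g φ) := fun φ =>
    Measurable.tsum fun i => (measurable_enorm_inner_weyl ħ φ _).pow_const 2
  have hgi : ∀ φ, ∫⁻ z in Z, g φ z =
      ENNReal.ofReal (2 * Real.pi * ħ) * ENNReal.ofReal (⟪φ, T φ⟫_ℂ).re := fun φ => by
    rw [← h, lintegral_tsum fun i => ((measurable_enorm_inner_weyl ħ φ _).pow_const 2).aemeasurable]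
  have hfin : ∀ φ, ∫⁻ z in Z, g φ z ≠ ∞ := fun φ => by rw [hgi]; finiteness
  have hpos : 0 ≤ 2 * Real.pi * ħ := by positivity
  have hw : weakIntegral (volume.restrict Z)
      (fun z => weyl ħ z.1 z.2 ∘L τ.op ∘L (weyl ħ z.1 z.2).adjoint)
        = ((2 * Real.pi * ħ : ℝ) : ℂ) • T := by
    refine weakIntegral_eq (fun φ => ?_) fun φ => ?_
    · simp_rw [τ.inner_conj_apply]
      exact (integrable_toReal_of_lintegral_ne_top (hgm φ).aemeasurable (hfin φ)).ofReal
    · simp_rw [τ.inner_conj_apply]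
      rw [integral_complex_ofReal, integral_toReal (hgm φ).aemeasurable
        (ae_lt_top (hgm φ) (hfin φ)), hgi, ENNReal.toReal_mul, ENNReal.toReal_ofReal hpos,
        ENNReal.toReal_ofReal (show 0 ≤ (⟪φ, T φ⟫_ℂ).re from hT.re_inner_nonneg_right φ), smul_apply,
        inner_smul_right, Complex.ofReal_mul _ (Complex.re _)]
      congr 1
      have h3 := hT.inner_nonneg_right φ
      exact (Complex.eq_re_of_ofReal_le (r := 0) (by simpa using h3))
  rw [covariantObservable, hw, smul_smul]
  have : (1 / (2 * Real.pi * ħ) : ℂ) * ((2 * Real.pi * ħ : ℝ) : ℂ) = 1 := by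
    push_cast
    have h1 : (ħ : ℂ) ≠ 0 := by exact_mod_cast hħ.ne'
    have h2 : (Real.pi : ℂ) ≠ 0 := by exact_mod_cast Real.pi_ne_zero
    field_simp
  rw [this, one_smul]

/-! ### Position and momentum distributions, and the marginals of the covariant observable -/

theorem ofReal_re_inner_positionKernel (κ : Kernel ℝ ℝ) [IsMarkovKernel κ] {X : Set ℝ}
    (hX : MeasurableSet X) (ψ : L2R) :
    ENNReal.ofReal (⟪ψ, (positionKernel κ).effect X ψ⟫_ℂ).re = ∫⁻ q, κ q X * ‖ψ q‖ₑ ^ 2 := by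
  have h : ⟪ψ, (positionKernel κ).effect X ψ⟫_ℂ
      = ((∫ q, (κ q).real X * ‖ψ q‖ ^ 2 : ℝ) : ℂ) := by
    change ⟪ψ, mulOp (fun q => ((κ q).real X : ℂ)) ψ⟫_ℂ = _
    rw [L2.inner_def, ← integral_complex_ofReal]
    refine integral_congr_ae ?_
    filter_upwards [mulOp_apply (memLp_kernel κ hX) ψ] with q hq
    rw [hq, RCLike.inner_apply', mul_left_comm, mul_comm _ (ψ q), Complex.mul_conj,
      Complex.normSq_eq_norm_sq]
    push_cast
    ring
  have hi : Integrable (fun q => (κ q).real X * ‖ψ q‖ ^ 2) := by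
    have h2 : Integrable (fun q => ‖ψ q‖ ^ 2) := (Lp.memLp ψ).integrable_norm_pow (by norm_num)
    refine h2.bdd_mul (c := 1) ?_ (Filter.Eventually.of_forall fun q => ?_)
    · exact (Kernel.measurable_coe κ hX).ennreal_toReal.aestronglyMeasurable
    · rw [Real.norm_of_nonneg measureReal_nonneg]; exact measureReal_le_one
  rw [h, Complex.ofReal_re, ofReal_integral_eq_lintegral_ofReal hi
    (Filter.Eventually.of_forall fun q => by positivity)]
  refine lintegral_congr fun q => ?_
  rw [ENNReal.ofReal_mul measureReal_nonneg, measureReal_def,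
    ENNReal.ofReal_toReal (measure_ne_top _ _), ENNReal.ofReal_pow (norm_nonneg _), ofReal_norm]

theorem DensityOperator.bornMeasure_positionKernel (ρ : DensityOperator L2R) {V : L2R →L[ℂ] L2R}
    (hV : ρ.op = V ∘L V.adjoint) (κ : Kernel ℝ ℝ) [IsMarkovKernel κ] {X : Set ℝ}
    (hX : MeasurableSet X) :
    ρ.bornMeasure (positionKernel κ) X = ∑' i, ∫⁻ q, κ q X * ‖V (traceBasis L2R i) q‖ₑ ^ 2 := by
  rw [ρ.bornMeasure_apply_of_eq hV _ hX]
  exact tsum_congr fun i => ofReal_re_inner_positionKernel κ hX _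

theorem measurable_enorm_sq (u : L2R) : Measurable fun x => ‖u x‖ₑ ^ 2 :=
  (Lp.stronglyMeasurable u).measurable.enorm.pow_const 2

theorem lintegral_indicator_one_mul {A : Set ℝ} (hA : MeasurableSet A) (g : ℝ → ℝ≥0∞) :
    ∫⁻ q, A.indicator 1 q * g q = ∫⁻ q in A, g q := by
  rw [← lintegral_indicator hA]
  refine lintegral_congr fun q => ?_
  by_cases hq : q ∈ A <;> simp [hq]

theorem DensityOperator.bornMeasure_position (ρ : DensityOperator L2R) {V : L2R →L[ℂ] L2R}
    (hV : ρ.op = V ∘L V.adjoint) {X : Set ℝ} (hX : MeasurableSet X) :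
    ρ.bornMeasure position X = ∑' i, ∫⁻ q in X, ‖V (traceBasis L2R i) q‖ₑ ^ 2 := by
  rw [position, ρ.bornMeasure_positionKernel hV _ hX]
  refine tsum_congr fun i => ?_
  rw [← lintegral_indicator_one_mul hX]
  refine lintegral_congr fun q => ?_
  rw [Kernel.id_apply, Measure.dirac_apply' _ hX]

theorem DensityOperator.bornMeasure_momentum (ħ : ℝ) (ρ : DensityOperator L2R)
    {V : L2R →L[ℂ] L2R} (hV : ρ.op = V ∘L V.adjoint) {Y : Set ℝ} (hY : MeasurableSet Y) :
    ρ.bornMeasure (momentum ħ) Y =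
      ∑' i, ∫⁻ ξ in (fun ξ => 2 * Real.pi * ħ * ξ) ⁻¹' Y,
        ‖fourierL2 (V (traceBasis L2R i)) ξ‖ₑ ^ 2 := by
  have hm : Measurable fun ξ : ℝ => 2 * Real.pi * ħ * ξ := by fun_prop
  rw [momentum, momentumKernel, ρ.bornMeasure_conj, DensityOperator.bornMeasure_positionKernel _
    (ρ.conj_op_eq _ hV) _ hY]
  refine tsum_congr fun i => ?_
  rw [← lintegral_indicator_one_mul (hm hY)]
  refine lintegral_congr fun q => ?_
  rw [Kernel.comap_apply, Kernel.id_apply, Measure.dirac_apply' _ hY]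
  rfl

theorem lintegral_preimage_sub_neg {X : Set ℝ} (hX : MeasurableSet X) (x : ℝ) (g : ℝ → ℝ≥0∞) :
    ∫⁻ y in (fun y => x + y) ⁻¹' X, g (-y) = ∫⁻ s in X, g (x - s) := by
  have hm : Measurable fun y : ℝ => x + y := by fun_prop
  rw [← lintegral_indicator (hm hX), ← lintegral_indicator hX, ← lintegral_sub_right_eq_self _ x]
  refine lintegral_congr fun s => ?_
  classical
  simp only [Set.indicator_apply, Set.mem_preimage, add_sub_cancel, neg_sub]

/-- The parity in the noise does its work here: the density `|f(-y)|²`, shifted by `x` through `s =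
x + y`, becomes `|f(x - s)|²`, the inner integrand of `lintegral_weyl_prod_univ`. -/
theorem translateKernel_positionNoise (τ : DensityOperator L2R) {X : Set ℝ}
    (hX : MeasurableSet X) (x : ℝ) :
    translateKernel (fun q => q) measurable_id (positionNoise τ) x X =
      ∑' i, ∫⁻ s in X, ‖τ.root (traceBasis L2R i) (x - s)‖ₑ ^ 2 := by
  have hm : Measurable fun y : ℝ => x + y := by fun_prop
  change (positionNoise τ).map (fun y => x + y) X = _
  rw [Measure.map_apply hm hX, positionNoise,
    DensityOperator.bornMeasure_position _ (τ.conj_op_eq parity τ.op_eq_root) (hm hX)]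
  refine tsum_congr fun i => ?_
  rw [← lintegral_preimage_sub_neg hX x fun y => ‖τ.root (traceBasis L2R i) y‖ₑ ^ 2]
  refine lintegral_congr_ae (ae_restrict_of_ae ?_)
  filter_upwards [parity_apply (τ.root (traceBasis L2R i))] with y hy
  rw [← hy]
  rfl

theorem translateKernel_momentumNoise (ħ : ℝ) (τ : DensityOperator L2R) {Y : Set ℝ}
    (hY : MeasurableSet Y) (ξ : ℝ) :
    translateKernel (fun p => p) measurable_id (momentumNoise ħ τ) (2 * Real.pi * ħ * ξ) Y =
      ∑' i, ∫⁻ s in (fun s => 2 * Real.pi * ħ * s) ⁻¹' Y,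
        ‖fourierL2 (τ.root (traceBasis L2R i)) (ξ - s)‖ₑ ^ 2 := by
  have hm : Measurable fun y : ℝ => 2 * Real.pi * ħ * ξ + y := by fun_prop
  have hc : Measurable fun s : ℝ => 2 * Real.pi * ħ * s := by fun_prop
  change (momentumNoise ħ τ).map (fun y => 2 * Real.pi * ħ * ξ + y) Y = _
  rw [Measure.map_apply hm hY, momentumNoise,
    DensityOperator.bornMeasure_momentum ħ _ (τ.conj_op_eq parity τ.op_eq_root) (hm hY)]
  refine tsum_congr fun i => ?_
  rw [← lintegral_preimage_sub_neg (hc hY) ξ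
    fun y => ‖fourierL2 (τ.root (traceBasis L2R i)) y‖ₑ ^ 2]
  have hset : (fun s => 2 * Real.pi * ħ * s) ⁻¹' ((fun y => 2 * Real.pi * ħ * ξ + y) ⁻¹' Y) =
      (fun y => ξ + y) ⁻¹' ((fun s => 2 * Real.pi * ħ * s) ⁻¹' Y) := by
    ext s
    simp only [Set.mem_preimage, mul_add]
  rw [hset]
  refine lintegral_congr_ae (ae_restrict_of_ae ?_)
  filter_upwards [parity_apply (fourierL2 (τ.root (traceBasis L2R i)))] with y hy
  rw [← hy, ← fourierL2_parity]
  rfl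

theorem measurable_lintegral_sub (X : Set ℝ) (u : L2R) :
    Measurable fun x => ∫⁻ s in X, ‖u (x - s)‖ₑ ^ 2 :=
  Measurable.lintegral_prod_right' (ν := volume.restrict X) (f := fun z : ℝ × ℝ =>
    ‖u (z.1 - z.2)‖ₑ ^ 2) ((measurable_enorm_sq u).comp (by fun_prop))

theorem lintegral_tsum_mul_enorm_sq (X : Set ℝ) (v : traceIndex L2R → L2R) (φ : L2R) :
    ∫⁻ x, (∑' i, ∫⁻ s in X, ‖v i (x - s)‖ₑ ^ 2) * ‖φ x‖ₑ ^ 2 =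
      ∑' i, ∫⁻ x, ‖φ x‖ₑ ^ 2 * ∫⁻ s in X, ‖v i (x - s)‖ₑ ^ 2 := by
  have hm : ∀ i, Measurable fun x => ‖φ x‖ₑ ^ 2 * ∫⁻ s in X, ‖v i (x - s)‖ₑ ^ 2 := fun i =>
    (measurable_enorm_sq φ).mul (measurable_lintegral_sub X (v i))
  rw [← lintegral_tsum fun i => (hm i).aemeasurable]
  refine lintegral_congr fun x => ?_
  rw [mul_comm, ENNReal.tsum_mul_left]

theorem covariantObservable_prod_univ {ħ : ℝ} (hħ : 0 < ħ) (τ : DensityOperator L2R) {X : Set ℝ}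
    (hX : MeasurableSet X) :
    covariantObservable ħ τ (X ×ˢ Set.univ) = (smearedPosition (positionNoise τ)).effect X := by
  refine covariantObservable_eq hħ τ ((smearedPosition _).isPositive X hX) fun φ => ?_
  rw [smearedPosition, ofReal_re_inner_positionKernel _ hX]
  simp_rw [lintegral_weyl_prod_univ hħ, translateKernel_positionNoise τ hX]
  rw [lintegral_tsum_mul_enorm_sq X (fun i => τ.root (traceBasis L2R i)), ENNReal.tsum_mul_left]

theorem ofReal_re_inner_smearedMomentum (ħ : ℝ) (ν : Measure ℝ) [IsProbabilityMeasure ν]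
    {Y : Set ℝ} (hY : MeasurableSet Y) (φ : L2R) :
    ENNReal.ofReal (⟪φ, (smearedMomentum ħ ν).effect Y φ⟫_ℂ).re =
      ∫⁻ ξ, translateKernel (fun p => p) measurable_id ν (2 * Real.pi * ħ * ξ) Y *
        ‖fourierL2 φ ξ‖ₑ ^ 2 := by
  have h := ofReal_re_inner_positionKernel ((translateKernel (fun p => p) measurable_id ν).comap
    (fun ξ => 2 * Real.pi * ħ * ξ) (by fun_prop)) hY (fourierL2 φ)
  rw [← inner_symm_apply fourierL2] at h
  exact h

theorem covariantObservable_univ_prod {ħ : ℝ} (hħ : 0 < ħ) (τ : DensityOperator L2R) {Y : Set ℝ}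
    (hY : MeasurableSet Y) :
    covariantObservable ħ τ (Set.univ ×ˢ Y) =
      (smearedMomentum ħ (momentumNoise ħ τ)).effect Y := by
  refine covariantObservable_eq hħ τ ((smearedMomentum ħ _).isPositive Y hY) fun φ => ?_
  rw [ofReal_re_inner_smearedMomentum ħ _ hY]
  simp_rw [lintegral_weyl_univ_prod hħ _ _ hY, translateKernel_momentumNoise ħ τ hY]
  rw [lintegral_tsum_mul_enorm_sq _ (fun i => fourierL2 (τ.root (traceBasis L2R i))),
    ENNReal.tsum_mul_left]

/-! ### Error bar widths -/

section Widths

theorem measurableSet_interval (x w : ℝ) : MeasurableSet (interval x w) := measurableSet_Icc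

theorem overallWidth_le {ε w x : ℝ} {p : Measure ℝ} (hw : 0 < w)
    (h : ENNReal.ofReal (1 - ε) ≤ p (interval x w)) : overallWidth ε p ≤ ENNReal.ofReal w :=
  iInf_le_of_le w (iInf_le_of_le hw (iInf_le _ ⟨x, h⟩))

/-- Continuity from below along intervals exhausting the line; a positive `ε` makes the target
strictly less than the total mass, so it is reached at a finite stage. -/
theorem exists_interval_ge (p : Measure ℝ) [IsProbabilityMeasure p] {ε : ℝ} (hε : 0 < ε) :
    ∃ w : ℝ, 0 < w ∧ ENNReal.ofReal (1 - ε) ≤ p (interval 0 w) := by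
  have hU : (⋃ n : ℕ, interval 0 (2 * n)) = Set.univ := by
    refine Set.eq_univ_of_forall fun x => Set.mem_iUnion.2 ?_
    obtain ⟨n, hn⟩ := exists_nat_ge |x|
    have := abs_le.1 hn
    exact ⟨n, by constructor <;> linarith [this.1, this.2]⟩
  have hmono : Monotone fun n : ℕ => interval 0 (2 * n) := fun m n h => by
    have : (m : ℝ) ≤ n := by exact_mod_cast h
    exact Set.Icc_subset_Icc (by linarith) (by linarith)
  have ht := tendsto_measure_iUnion_atTop (μ := p) hmono
  rw [hU, measure_univ] at ht
  have hlt : ENNReal.ofReal (1 - ε) < 1 := by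
    rw [ENNReal.ofReal_lt_one]; linarith
  obtain ⟨n, hn, hn1⟩ := ((ht.eventually (lt_mem_nhds hlt)).and
    (Filter.eventually_ge_atTop 1)).exists
  have : (1 : ℝ) ≤ n := by exact_mod_cast hn1
  exact ⟨2 * n, by linarith, hn.le⟩

theorem overallWidth_ne_top (p : Measure ℝ) [IsProbabilityMeasure p] {ε : ℝ} (hε : 0 < ε) :
    overallWidth ε p ≠ ∞ := by
  obtain ⟨w, hw, h⟩ := exists_interval_ge p hε
  exact ne_top_of_le_ne_top ENNReal.ofReal_ne_top (overallWidth_le hw h)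

variable {H : Type*} [NormedAddCommGroup H] [InnerProductSpace ℂ H] [CompleteSpace H]

/-- The bias-free error bar width is at most the gross error bar width. -/
theorem biasFreeErrorBarWidth_le (ε : ℝ) (E₁ E : Observable ℝ H) :
    biasFreeErrorBarWidth ε E₁ E ≤ grossErrorBarWidth ε E₁ E := by
  refine le_iInf₂ fun δ hδ => le_iInf fun w => le_iInf₂ fun hw h => ?_
  -- The infimum defining the overall width need not be attained. Halving `δ` makes the bound
  -- strict, so some interval of length less than `δ` carries the full mass.
  refine iInf₂_le_of_le (δ / 2) (half_pos hδ) (iSup₂_le fun ρ hρ => ?_)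
  have hlt : overallWidth 0 (ρ.bornMeasure E) < ENNReal.ofReal δ :=
    hρ.trans_lt ((ENNReal.ofReal_lt_ofReal_iff hδ).2 (half_lt_self hδ))
  simp only [overallWidth, iInf_lt_iff] at hlt
  obtain ⟨w', hw', ⟨x, hx⟩, hlt⟩ := hlt
  have hle : w' ≤ δ := ((ENNReal.ofReal_lt_ofReal_iff hδ).1 hlt).le
  refine overallWidth_le hw (h x ρ (le_antisymm prob_le_one ?_))
  have h1 : (1 : ℝ≥0∞) = ENNReal.ofReal (1 - 0) := by simp
  rw [h1]
  exact hx.trans (measure_mono (Set.Icc_subset_Icc (by linarith) (by linarith)))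

/-- The convolution's mass of an interval is the `m`-average of the `μ`-masses of its translates. If
all of these were below `c`, so would be the average. -/
theorem conv_interval_le (m μ : Measure ℝ) [IsProbabilityMeasure m] [IsProbabilityMeasure μ]
    {x w : ℝ} {c : ℝ≥0∞} (h : c ≤ (m ∗ μ) (interval x w)) : ∃ y, c ≤ μ (interval y w) := by
  by_contra! hc
  have hpre : ∀ q, (fun y => q + y) ⁻¹' interval x w = interval (x - q) w := fun q => by
    ext y
    simp only [interval, Set.mem_preimage, Set.mem_Icc]
    constructor <;> rintro ⟨h1, h2⟩ <;> constructor <;> linarith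
  have h1 : (m ∗ μ) (interval x w) = ∫⁻ q, μ (interval (x - q) w) ∂m := by
    rw [Measure.conv, Measure.map_apply (by fun_prop) (measurableSet_interval _ _),
      Measure.prod_apply ((measurable_add) (measurableSet_interval _ _))]
    refine lintegral_congr fun q => ?_
    rw [← hpre]
    rfl
  have hm : Measurable fun q => μ (interval (x - q) w) := by
    simp_rw [← hpre]
    exact measurable_measure_prodMk_left (measurable_add (measurableSet_interval x w))
  have h2 : ∫⁻ q, μ (interval (x - q) w) ∂m < ∫⁻ _, c ∂m :=
    lintegral_strict_mono (IsProbabilityMeasure.ne_zero m) aemeasurable_const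
      (by rw [← h1]; finiteness) (Filter.Eventually.of_forall fun q => hc _)
  rw [← h1, lintegral_const, measure_univ, mul_one] at h2
  exact absurd h (not_le.2 h2)

theorem overallWidth_le_overallWidth_conv (ε : ℝ) (m μ : Measure ℝ) [IsProbabilityMeasure m]
    [IsProbabilityMeasure μ] : overallWidth ε μ ≤ overallWidth ε (m ∗ μ) := by
  refine le_iInf fun w => le_iInf₂ fun hw ⟨x, hx⟩ => ?_
  obtain ⟨y, hy⟩ := conv_interval_le m μ hx
  exact overallWidth_le hw hy

/-- If `E₁` is obtained from `E` by adding independent noise with distribution `μ`, then the gross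
error bar width is finite. -/
theorem grossErrorBarWidth_ne_top {E₁ E : Observable ℝ H} {μ : Measure ℝ} [IsProbabilityMeasure μ]
    (hE : ∀ ρ : DensityOperator H, ρ.bornMeasure E₁ = ρ.bornMeasure E ∗ μ) {ε : ℝ} (hε : 0 < ε) :
    grossErrorBarWidth ε E₁ E ≠ ∞ := by
  obtain ⟨w, hw, h⟩ := exists_interval_ge μ hε
  refine ne_top_of_le_ne_top (b := ENNReal.ofReal (w + 1)) ENNReal.ofReal_ne_top ?_
  -- An input within `1/2` of `x` plus noise within `w/2` of `0` lands within `(w + 1)/2` of `x`.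
  refine iInf₂_le_of_le 1 one_pos (iInf_le_of_le (w + 1) (iInf₂_le_of_le (by linarith) ?_ le_rfl))
  intro x ρ hρ
  rw [hE, Measure.conv, Measure.map_apply (by fun_prop) (measurableSet_interval _ _)]
  refine h.trans ?_
  rw [← one_mul (μ _), ← hρ, ← Measure.prod_prod]
  refine measure_mono ?_
  rintro ⟨q, y⟩ ⟨hq, hy⟩
  simp only [interval, Set.mem_Icc] at hq hy
  simp only [interval, Set.mem_preimage, Set.mem_Icc]
  constructor <;> linarith [hq.1, hq.2, hy.1, hy.2]

/-- If `E₁` is obtained from `E` by adding independent noise with distribution `μ`, and `E` has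
arbitrarily well localised states, then the bias-free error bar width is at least the overall
width of `μ`. -/
theorem overallWidth_le_biasFreeErrorBarWidth {E₁ E : Observable ℝ H} {μ : Measure ℝ}
    [IsProbabilityMeasure μ]
    (hE : ∀ ρ : DensityOperator H, ρ.bornMeasure E₁ = ρ.bornMeasure E ∗ μ)
    (hloc : ∀ δ > 0, ∃ ρ : DensityOperator H, ρ.bornMeasure E (interval 0 δ) = 1) (ε : ℝ) :
    overallWidth ε μ ≤ biasFreeErrorBarWidth ε E₁ E := by
  refine le_iInf₂ fun δ hδ => ?_
  obtain ⟨ρ, hρ⟩ := hloc δ hδ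
  refine le_iSup₂_of_le ρ (overallWidth_le (x := 0) hδ (by rw [hρ]; simp)) ?_
  rw [hE]
  exact overallWidth_le_overallWidth_conv ε _ μ

/-- The pure state of a unit vector. -/
theorem exists_pureState {ψ : H} (hψ : ‖ψ‖ = 1) :
    ∃ ρ : DensityOperator H, ∀ {Ω : Type} [MeasurableSpace Ω] (E : Observable Ω H) {X : Set Ω},
      MeasurableSet X → ρ.bornMeasure E X = ENNReal.ofReal (⟪ψ, E.effect X ψ⟫_ℂ).re := by
  set T : H →L[ℂ] H := InnerProductSpace.rankOne ℂ ψ ψ with hT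
  have hTadj : T.adjoint = T := by
    simp [hT]
  have hTT : T ∘L T = T := by
    ext x
    simp [hT, inner_self_eq_norm_sq_to_K, hψ]
  have hTT' : T = T.adjoint ∘L T := by rw [hTadj, hTT]
  have hsum : ∑' i, ‖T (traceBasis H i)‖ₑ ^ 2 = 1 := by
    have h := (enorm_sq_eq_tsum (traceBasis H) ψ).2
    have h1 : ‖ψ‖ₑ = 1 := by rw [← ofReal_norm, hψ]; simp
    rw [h1, one_pow] at h
    rw [h]
    refine tsum_congr fun i => ?_
    rw [hT, InnerProductSpace.rankOne_apply, enorm_smul, h1, mul_one]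
  refine ⟨⟨T, ?_, ?_⟩, ?_⟩
  · rw [hTT']
    exact ContinuousLinearMap.isPositive_adjoint_comp_self T
  · rw [hTT', trace_adjoint_comp_self, hsum]
    simp
  · intro Ω _ E X hX
    rw [DensityOperator.bornMeasure_apply_of_eq _ (V := T) (by
      change T = T ∘L T.adjoint; rw [hTadj, hTT]) E hX]
    have h : ∀ x, ENNReal.ofReal (⟪T x, E.effect X (T x)⟫_ℂ).re =
        ‖⟪ψ, x⟫_ℂ‖ₑ ^ 2 * ENNReal.ofReal (⟪ψ, E.effect X ψ⟫_ℂ).re := fun x => by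
      rw [hT, InnerProductSpace.rankOne_apply, map_smul, inner_smul_left, inner_smul_right,
        ← mul_assoc, mul_comm (starRingEnd ℂ _), Complex.mul_conj, Complex.re_ofReal_mul,
        ENNReal.ofReal_mul (Complex.normSq_nonneg _), Complex.normSq_eq_norm_sq,
        ENNReal.ofReal_pow (norm_nonneg _), ofReal_norm]
    simp_rw [h]
    rw [ENNReal.tsum_mul_right, ← (enorm_sq_eq_tsum (traceBasis H) ψ).2, ← ofReal_norm, hψ]
    simp

end Widths

/-! ### Smeared observables and localised states -/

theorem DensityOperator.bornMeasure_position_eq_withDensity (ρ : DensityOperator L2R) :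
    ρ.bornMeasure position =
      volume.withDensity fun q => ∑' i, ‖ρ.root (traceBasis L2R i) q‖ₑ ^ 2 := by
  ext X hX
  rw [ρ.bornMeasure_position ρ.op_eq_root hX, withDensity_apply _ hX,
    lintegral_tsum fun i => (measurable_enorm_sq _).aemeasurable]

/-- Smearing is classical post-processing: the kernel acts on the sharp outcome distribution, whose
density is `∑ |ρ^{1/2} eᵢ|²`. -/
theorem DensityOperator.bornMeasure_positionKernel_eq_lintegral (ρ : DensityOperator L2R)
    (κ : Kernel ℝ ℝ) [IsMarkovKernel κ] {X : Set ℝ} (hX : MeasurableSet X) :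
    ρ.bornMeasure (positionKernel κ) X = ∫⁻ q, κ q X ∂ρ.bornMeasure position := by
  have hκ : Measurable fun q => κ q X := Kernel.measurable_coe κ hX
  have hm : ∀ i, Measurable fun q => κ q X * ‖ρ.root (traceBasis L2R i) q‖ₑ ^ 2 := fun i =>
    hκ.mul (measurable_enorm_sq _)
  rw [ρ.bornMeasure_positionKernel ρ.op_eq_root κ hX, ρ.bornMeasure_position_eq_withDensity,
    lintegral_withDensity_eq_lintegral_mul _
      (Measurable.tsum fun i => measurable_enorm_sq _) hκ,
    ← lintegral_tsum fun i => (hm i).aemeasurable]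
  refine lintegral_congr fun q => ?_
  rw [Pi.mul_apply, mul_comm, ENNReal.tsum_mul_left]

theorem DensityOperator.bornMeasure_momentumKernel_eq_lintegral (ħ : ℝ) (ρ : DensityOperator L2R)
    (κ : Kernel ℝ ℝ) [IsMarkovKernel κ] {Y : Set ℝ} (hY : MeasurableSet Y) :
    ρ.bornMeasure (momentumKernel ħ κ) Y =
      ∫⁻ ξ, κ (2 * Real.pi * ħ * ξ) Y ∂(ρ.conj fourierL2.toLinearIsometry).bornMeasure position := by
  rw [momentumKernel, ρ.bornMeasure_conj,
    DensityOperator.bornMeasure_positionKernel_eq_lintegral _ _ hY]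
  rfl

theorem DensityOperator.bornMeasure_momentum_eq_map (ħ : ℝ) (ρ : DensityOperator L2R) :
    ρ.bornMeasure (momentum ħ) =
      ((ρ.conj fourierL2.toLinearIsometry).bornMeasure position).map
        fun ξ => 2 * Real.pi * ħ * ξ := by
  have hm : Measurable fun ξ : ℝ => 2 * Real.pi * ħ * ξ := by fun_prop
  ext Y hY
  rw [momentum, ρ.bornMeasure_momentumKernel_eq_lintegral ħ _ hY, Measure.map_apply hm hY,
    ← lintegral_indicator_one (hm hY)]
  refine lintegral_congr fun ξ => ?_
  rw [Kernel.id_apply, Measure.dirac_apply' _ hY]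
  rfl

theorem conv_apply_eq_lintegral_translateKernel (m μ : Measure ℝ) [IsProbabilityMeasure μ]
    {X : Set ℝ} (hX : MeasurableSet X) :
    (m ∗ μ) X = ∫⁻ q, translateKernel (fun q => q) measurable_id μ q X ∂m := by
  rw [Measure.conv, Measure.map_apply (by fun_prop) hX, Measure.prod_apply (measurable_add hX)]
  refine lintegral_congr fun q => ?_
  change _ = μ.map (fun y => q + y) X
  rw [Measure.map_apply (by fun_prop) hX]
  rfl

theorem DensityOperator.bornMeasure_smearedPosition (ρ : DensityOperator L2R) (μ : Measure ℝ)
    [IsProbabilityMeasure μ] :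
    ρ.bornMeasure (smearedPosition μ) = ρ.bornMeasure position ∗ μ := by
  ext X hX
  rw [conv_apply_eq_lintegral_translateKernel _ _ hX]
  exact ρ.bornMeasure_positionKernel_eq_lintegral _ hX

theorem DensityOperator.bornMeasure_smearedMomentum (ħ : ℝ) (ρ : DensityOperator L2R)
    (ν : Measure ℝ) [IsProbabilityMeasure ν] :
    ρ.bornMeasure (smearedMomentum ħ ν) = ρ.bornMeasure (momentum ħ) ∗ ν := by
  ext Y hY
  rw [conv_apply_eq_lintegral_translateKernel _ _ hY, ρ.bornMeasure_momentum_eq_map,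
    lintegral_map (Kernel.measurable_coe _ hY) (by fun_prop)]
  exact ρ.bornMeasure_momentumKernel_eq_lintegral ħ _ hY

theorem exists_localised_unit_vector {δ : ℝ} (hδ : 0 < δ) :
    ∃ ψ : L2R, ‖ψ‖ = 1 ∧ ∫⁻ q in interval 0 δ, ‖ψ q‖ₑ ^ 2 = 1 := by
  have hv : volume (interval 0 δ) = ENNReal.ofReal δ := by
    rw [interval, Real.volume_Icc]; congr 1; ring
  set ψ : L2R := indicatorConstLp 2 (measurableSet_interval 0 δ) (by rw [hv]; finiteness)
    ((√δ : ℝ) : ℂ)⁻¹ with hψ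
  have h1 : ‖ψ‖ = 1 := by
    rw [hψ, norm_indicatorConstLp (by norm_num) (by norm_num), measureReal_def, hv,
      ENNReal.toReal_ofReal hδ.le, norm_inv, Complex.norm_real,
      Real.norm_of_nonneg (Real.sqrt_nonneg _), Real.sqrt_eq_rpow]
    norm_num
    exact inv_mul_cancel₀ (by positivity)
  refine ⟨ψ, h1, ?_⟩
  have h2 : ∫⁻ q in interval 0 δ, ‖ψ q‖ₑ ^ 2 = ∫⁻ q, ‖ψ q‖ₑ ^ 2 := by
    rw [← lintegral_indicator (measurableSet_interval 0 δ)]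
    refine lintegral_congr_ae ?_
    filter_upwards [indicatorConstLp_coeFn (p := 2) (hs := measurableSet_interval 0 δ)
      (hμs := by rw [hv]; finiteness) (c := ((√δ : ℝ) : ℂ)⁻¹)] with q hq
    by_cases hqm : q ∈ interval 0 δ
    · simp [hqm]
    · rw [hψ, hq]
      simp [hqm]
  rw [h2, lintegral_enorm_sq, ← ofReal_norm, h1]
  simp

theorem exists_localised_position {δ : ℝ} (hδ : 0 < δ) :
    ∃ ρ : DensityOperator L2R, ρ.bornMeasure position (interval 0 δ) = 1 := by
  obtain ⟨ψ, h1, h2⟩ := exists_localised_unit_vector hδ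
  obtain ⟨ρ, hρ⟩ := exists_pureState h1
  refine ⟨ρ, ?_⟩
  rw [hρ position (measurableSet_interval 0 δ), position,
    ofReal_re_inner_positionKernel _ (measurableSet_interval 0 δ), ← h2,
    ← lintegral_indicator_one_mul (measurableSet_interval 0 δ)]
  refine lintegral_congr fun q => ?_
  rw [Kernel.id_apply, Measure.dirac_apply' _ (measurableSet_interval 0 δ)]

theorem preimage_mul_interval {c : ℝ} (hc : 0 < c) (x w : ℝ) :
    (fun s => c * s) ⁻¹' interval x w = interval (x / c) (w / c) := by
  ext s
  simp only [interval, Set.mem_preimage, Set.mem_Icc]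
  have e1 : x / c - w / c / 2 = (x - w / 2) / c := by ring
  have e2 : x / c + w / c / 2 = (x + w / 2) / c := by ring
  rw [e1, e2, div_le_iff₀' hc, le_div_iff₀' hc]

theorem exists_localised_momentum {ħ : ℝ} (hħ : 0 < ħ) {δ : ℝ} (hδ : 0 < δ) :
    ∃ ρ : DensityOperator L2R, ρ.bornMeasure (momentum ħ) (interval 0 δ) = 1 := by
  have hc : 0 < 2 * Real.pi * ħ := by positivity
  -- Momentum is `2πħ` times the frequency, so localisation within `δ` in momentum means `δ / (2πħ)`
  -- in frequency.
  obtain ⟨ψ, h1, h2⟩ := exists_localised_unit_vector (div_pos hδ hc)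
  obtain ⟨ρ, hρ⟩ := exists_pureState (ψ := fourierL2.symm ψ)
    (by rw [LinearIsometryEquiv.norm_map, h1])
  refine ⟨ρ, ?_⟩
  have hm : MeasurableSet (interval 0 (δ / (2 * Real.pi * ħ))) := measurableSet_interval _ _
  have hm' : MeasurableSet (interval 0 δ) := measurableSet_interval _ _
  have hpre := preimage_mul_interval hc 0 δ
  rw [zero_div] at hpre
  rw [hρ (momentum ħ) hm']
  have h4 := ofReal_re_inner_positionKernel (Kernel.id.comap
    (fun ξ => 2 * Real.pi * ħ * ξ) (by fun_prop)) hm' ψ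
  rw [← fourierL2.apply_symm_apply ψ, ← inner_symm_apply fourierL2] at h4
  refine Eq.trans h4 ?_
  rw [← h2, ← lintegral_indicator_one_mul hm]
  refine lintegral_congr fun q => ?_
  rw [Kernel.comap_apply, Kernel.id_apply, Measure.dirac_apply' _ hm', ← hpre,
    fourierL2.apply_symm_apply]
  rfl

/-! ### The uncertainty relation for overall widths -/

section LandauPollak

variable {K : Type*} [NormedAddCommGroup K] [InnerProductSpace ℂ K]

/-- The Landau–Pollak inequality: if `a` and `b` are orthogonal projections of the unit vector `Φ`
and the cosine of the angle between `a` and `b` is at most `c`, then the angles between `Φ` and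
`a` and between `Φ` and `b` cannot both be small. -/
theorem landau_pollak {Φ a b : K} (hΦ : ‖Φ‖ = 1) (ha : ⟪Φ, a⟫_ℂ = ((‖a‖ ^ 2 : ℝ) : ℂ))
    (hb : ⟪Φ, b⟫_ℂ = ((‖b‖ ^ 2 : ℝ) : ℂ)) {c : ℝ} (hab : (⟪a, b⟫_ℂ).re ≤ c * (‖a‖ * ‖b‖))
    {ε₁ ε₂ : ℝ} (hε₁ : ε₁ < 1) (hε₂ : ε₂ < 1) (h₁ : 1 - ε₁ ≤ ‖a‖ ^ 2) (h₂ : 1 - ε₂ ≤ ‖b‖ ^ 2) :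
    √((1 - ε₁) * (1 - ε₂)) - √(ε₁ * ε₂) ≤ c := by
  have hpos : ∀ {v : K} {ε : ℝ}, ε < 1 → 1 - ε ≤ ‖v‖ ^ 2 → 0 < ‖v‖ := fun {v ε} h h' => by
    rcases (norm_nonneg v).eq_or_lt with h0 | h0
    · rw [← h0] at h'; norm_num at h'; linarith
    · exact h0
  have hle : ∀ {v : K}, ⟪Φ, v⟫_ℂ = ((‖v‖ ^ 2 : ℝ) : ℂ) → ‖v‖ ≤ 1 := fun {v} h => by
    have h3 := norm_inner_le_norm (𝕜 := ℂ) Φ v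
    rw [h, hΦ, Complex.norm_real, Real.norm_of_nonneg (by positivity)] at h3
    by_contra! hc
    nlinarith
  have hnorm : ∀ {v : K}, ⟪Φ, v⟫_ℂ = ((‖v‖ ^ 2 : ℝ) : ℂ) →
      ‖v - ((‖v‖ ^ 2 : ℝ) : ℂ) • Φ‖ = ‖v‖ * √(1 - ‖v‖ ^ 2) := fun {v} h => by
    have h4 : ‖v - ((‖v‖ ^ 2 : ℝ) : ℂ) • Φ‖ ^ 2 = ‖v‖ ^ 2 * (1 - ‖v‖ ^ 2) := by
      rw [@norm_sub_sq ℂ, inner_smul_right, ← inner_conj_symm, h, norm_smul, hΦ,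
        Complex.conj_ofReal, ← Complex.ofReal_mul, Complex.norm_real]
      simp only [RCLike.re_eq_complex_re, Complex.ofReal_re, norm_pow, norm_norm, mul_one]
      ring
    have h5 : 0 ≤ 1 - ‖v‖ ^ 2 := by nlinarith [hle h, norm_nonneg v]
    rw [← Real.sqrt_sq (norm_nonneg (v - _)), h4, Real.sqrt_mul (by positivity),
      Real.sqrt_sq (norm_nonneg v)]
  have hin : (⟪a - ((‖a‖ ^ 2 : ℝ) : ℂ) • Φ, b - ((‖b‖ ^ 2 : ℝ) : ℂ) • Φ⟫_ℂ).re
      = (⟪a, b⟫_ℂ).re - ‖a‖ ^ 2 * ‖b‖ ^ 2 := by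
    have h6 : ⟪a, Φ⟫_ℂ = ((‖a‖ ^ 2 : ℝ) : ℂ) := by
      rw [← inner_conj_symm, ha, Complex.conj_ofReal]
    have h7 : ⟪Φ, Φ⟫_ℂ = 1 := by rw [inner_self_eq_norm_sq_to_K, hΦ]; simp
    simp only [inner_sub_left, inner_sub_right, inner_smul_left, inner_smul_right, hb, h6, h7,
      Complex.conj_ofReal]
    rw [← Complex.ofReal_mul, mul_one, sub_self, mul_zero, sub_zero, Complex.sub_re,
      Complex.ofReal_re]
  -- With `‖a‖ = cos α` and `‖b‖ = cos β`, Cauchy–Schwarz for the components orthogonal to `Φ` gives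
  -- `cos α cos β (cos α cos β - sin α sin β) ≤ Re ⟨a, b⟩`. Dividing by `‖a‖ ‖b‖`, which is positive
  -- as both `εᵢ < 1`, yields `cos (α + β) ≤ c`.
  have hcs := (abs_le.1 ((Complex.abs_re_le_norm _).trans (norm_inner_le_norm (𝕜 := ℂ)
    (a - ((‖a‖ ^ 2 : ℝ) : ℂ) • Φ) (b - ((‖b‖ ^ 2 : ℝ) : ℂ) • Φ)))).1
  rw [hin, hnorm ha, hnorm hb] at hcs
  have hpa := hpos hε₁ h₁
  have hpb := hpos hε₂ h₂
  have hmain : ‖a‖ * ‖b‖ - √(1 - ‖a‖ ^ 2) * √(1 - ‖b‖ ^ 2) ≤ c := by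
    have : (‖a‖ * ‖b‖ - √(1 - ‖a‖ ^ 2) * √(1 - ‖b‖ ^ 2)) * (‖a‖ * ‖b‖) ≤ c * (‖a‖ * ‖b‖) := by
      nlinarith
    exact le_of_mul_le_mul_right this (by positivity)
  have hs1 : √((1 - ε₁) * (1 - ε₂)) ≤ ‖a‖ * ‖b‖ := by
    rw [Real.sqrt_le_left (by positivity), mul_pow]
    gcongr
  have hs2 : √(1 - ‖a‖ ^ 2) * √(1 - ‖b‖ ^ 2) ≤ √(ε₁ * ε₂) := by
    have h8 : 0 ≤ 1 - ‖a‖ ^ 2 := by nlinarith [hle ha, norm_nonneg a]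
    have h9 : 0 ≤ 1 - ‖b‖ ^ 2 := by nlinarith [hle hb, norm_nonneg b]
    rw [← Real.sqrt_mul h8]
    refine Real.sqrt_le_sqrt (mul_le_mul (by linarith) (by linarith) h9 (by linarith))
  linarith

/-- The Landau–Pollak inequality for mixtures of (unnormalised) vectors. -/
theorem landau_pollak_of_hasSum {ι : Type*} {f : ι → K} (hf : HasSum (fun i => ‖f i‖ ^ 2) 1)
    {A B : K → K} (hA : ∀ x, ⟪x, A x⟫_ℂ = ((‖A x‖ ^ 2 : ℝ) : ℂ))
    (hB : ∀ x, ⟪x, B x⟫_ℂ = ((‖B x‖ ^ 2 : ℝ) : ℂ)) {c : ℝ} (hc : 0 ≤ c)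
    (hAB : ∀ x y, (⟪A x, B y⟫_ℂ).re ≤ c * (‖A x‖ * ‖B y‖))
    {ε₁ ε₂ : ℝ} (hε₁ : ε₁ < 1) (hε₂ : ε₂ < 1) (h₁ : 1 - ε₁ ≤ ∑' i, ‖A (f i)‖ ^ 2)
    (h₂ : 1 - ε₂ ≤ ∑' i, ‖B (f i)‖ ^ 2) :
    √((1 - ε₁) * (1 - ε₂)) - √(ε₁ * ε₂) ≤ c := by
  have hle : ∀ {P : K → K}, (∀ x, ⟪x, P x⟫_ℂ = ((‖P x‖ ^ 2 : ℝ) : ℂ)) → ∀ x, ‖P x‖ ≤ ‖x‖ :=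
    fun {P} h x => by
      have h3 := norm_inner_le_norm (𝕜 := ℂ) x (P x)
      rw [h, Complex.norm_real, Real.norm_of_nonneg (by positivity)] at h3
      by_contra! hlt
      nlinarith [norm_nonneg x]
  have hmem : ∀ {g : ι → K}, (∀ i, ‖g i‖ ≤ ‖f i‖) → Memℓp g 2 := fun {g} hg => by
    refine memℓp_gen ?_
    have : Summable fun i => ‖g i‖ ^ 2 :=
      Summable.of_nonneg_of_le (fun i => by positivity)
        (fun i => pow_le_pow_left₀ (norm_nonneg _) (hg i) 2) hf.summable
    simpa using this
  have hnorm : ∀ v : lp (fun _ : ι => K) 2, HasSum (fun i => ‖v i‖ ^ 2) (‖v‖ ^ 2) := fun v => by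
    have := lp.hasSum_norm (p := 2) (by norm_num) v
    simpa using this
  -- Purification: the whole family is one unit vector of `ℓ²(ι; K)`, with `A` and `B` acting
  -- componentwise. The angle bound passes to the sum by Cauchy–Schwarz over `ι`.
  set Φ : lp (fun _ : ι => K) 2 := ⟨f, hmem fun i => le_rfl⟩ with hΦ
  set a : lp (fun _ : ι => K) 2 := ⟨fun i => A (f i), hmem fun i => hle hA _⟩ with ha
  set b : lp (fun _ : ι => K) 2 := ⟨fun i => B (f i), hmem fun i => hle hB _⟩ with hb
  have hna : HasSum (fun i => ‖A (f i)‖ ^ 2) (‖a‖ ^ 2) := hnorm a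
  have hnb : HasSum (fun i => ‖B (f i)‖ ^ 2) (‖b‖ ^ 2) := hnorm b
  have h1 : ‖Φ‖ = 1 := by
    have := (hnorm Φ).unique hf
    exact (pow_eq_one_iff_of_nonneg (norm_nonneg Φ) two_ne_zero).1 this
  refine landau_pollak (Φ := Φ) (a := a) (b := b) h1 ?_ ?_ ?_ hε₁ hε₂
    (by rwa [← hna.tsum_eq]) (by rwa [← hnb.tsum_eq])
  · refine (lp.hasSum_inner Φ a).unique ?_
    have := (Complex.hasSum_ofReal).2 hna
    exact this.congr_fun fun i => hA (f i)
  · refine (lp.hasSum_inner Φ b).unique ?_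
    have := (Complex.hasSum_ofReal).2 hnb
    exact this.congr_fun fun i => hB (f i)
  · have hin : HasSum (fun i => (⟪A (f i), B (f i)⟫_ℂ).re) (⟪a, b⟫_ℂ).re :=
      Complex.hasSum_re (lp.hasSum_inner a b)
    have hq : Real.HolderConjugate 2 2 := Real.HolderConjugate.two_two
    have hcs := Real.summable_and_inner_le_Lp_mul_Lq_tsum_of_nonneg hq
      (f := fun i => ‖A (f i)‖) (g := fun i => ‖B (f i)‖) (fun _ => norm_nonneg _)
      (fun _ => norm_nonneg _) (by simpa using hna.summable) (by simpa using hnb.summable)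
    simp only [Real.rpow_two, hna.tsum_eq, hnb.tsum_eq, ← Real.sqrt_eq_rpow,
      Real.sqrt_sq (norm_nonneg _)] at hcs
    calc (⟪a, b⟫_ℂ).re ≤ ∑' i, c * (‖A (f i)‖ * ‖B (f i)‖) :=
          hasSum_le (fun i => hAB _ _) hin (hcs.1.mul_left c).hasSum
      _ = c * ∑' i, ‖A (f i)‖ * ‖B (f i)‖ := tsum_mul_left
      _ ≤ c * (‖a‖ * ‖b‖) := by gcongr; exact hcs.2

end LandauPollak

/-! ### Position and momentum projections and the Hilbert–Schmidt bound. -/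

/-- Multiplication by the indicator function of `J`. -/
def indicatorOp (J : Set ℝ) : L2R →L[ℂ] L2R := mulOp (J.indicator 1)

theorem indicatorOp_apply {J : Set ℝ} (hJ : MeasurableSet J) (u : L2R) :
    indicatorOp J u =ᵐ[volume] J.indicator u := by
  have hm : MemLp (J.indicator (1 : ℝ → ℂ)) ∞ (volume : Measure ℝ) := by
    refine memLp_top_of_bound (C := 1) (measurable_one.indicator hJ).aestronglyMeasurable
      (Filter.Eventually.of_forall fun x => ?_)
    by_cases hx : x ∈ J <;> simp [hx]
  filter_upwards [mulOp_apply hm u] with x hx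
  rw [indicatorOp, hx]
  by_cases hxJ : x ∈ J <;> simp [hxJ]

theorem inner_indicatorOp {J : Set ℝ} (hJ : MeasurableSet J) (u v : L2R) :
    ⟪u, indicatorOp J v⟫_ℂ = ⟪indicatorOp J u, indicatorOp J v⟫_ℂ := by
  rw [L2.inner_def, L2.inner_def]
  refine integral_congr_ae ?_
  filter_upwards [indicatorOp_apply hJ u, indicatorOp_apply hJ v] with x hu hv
  rw [hu, hv]
  by_cases hx : x ∈ J <;> simp [hx]

theorem enorm_indicatorOp_sq {J : Set ℝ} (hJ : MeasurableSet J) (u : L2R) :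
    ‖indicatorOp J u‖ₑ ^ 2 = ∫⁻ x in J, ‖u x‖ₑ ^ 2 := by
  rw [← lintegral_enorm_sq, ← lintegral_indicator hJ]
  refine lintegral_congr_ae ?_
  filter_upwards [indicatorOp_apply hJ u] with x hx
  rw [hx]
  by_cases hxJ : x ∈ J <;> simp [hxJ]

/-- The Fourier transform of a function supported in `J` is bounded. -/
theorem enorm_fourierL2_indicatorOp_le {J : Set ℝ} (hJ : MeasurableSet J) (hJv : volume J ≠ ∞)
    (u : L2R) : ∀ᵐ ξ, ‖fourierL2 (indicatorOp J u) ξ‖ₑ ^ 2 ≤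
      volume J * ‖indicatorOp J u‖ₑ ^ 2 := by
  set g : ℝ → ℂ := J.indicator u with hg
  have hae := indicatorOp_apply hJ u
  have hg2 : MemLp g 2 := (Lp.memLp u).indicator hJ
  have : IsFiniteMeasure (volume.restrict J) := ⟨by simpa using hJv.lt_top⟩
  have hu2 : MemLp u 2 (volume.restrict J) := (Lp.memLp u).restrict J
  have hg1 : Integrable g := (integrable_indicator_iff hJ).2
    (memLp_one_iff_integrable.1 (hu2.mono_exponent (by norm_num)))
  have heq : indicatorOp J u = hg2.toLp g := Lp.ext (hae.trans hg2.coeFn_toLp.symm)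
  -- Cauchy–Schwarz on `J`; the supremum of the Fourier integral is then controlled by the `L¹`
  -- norm.
  have hL1 : eLpNorm u 1 (volume.restrict J) ^ 2 ≤ volume J * ‖indicatorOp J u‖ₑ ^ 2 := by
    have h1 := eLpNorm_le_eLpNorm_mul_rpow_measure_univ (p := 1) (q := 2) (by norm_num) hu2.1
    have h2 : ‖indicatorOp J u‖ₑ = eLpNorm u 2 (volume.restrict J) := by
      rw [Lp.enorm_def, eLpNorm_congr_ae hae, eLpNorm_indicator_eq_eLpNorm_restrict hJ]
    rw [h2, mul_comm]
    refine (pow_le_pow_left' h1 2).trans_eq ?_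
    rw [mul_pow, Measure.restrict_apply_univ, ← ENNReal.rpow_natCast (volume J ^ _),
      ← ENNReal.rpow_mul]
    norm_num
  rw [heq] at hL1 ⊢
  filter_upwards [fourierL2_toLp hg1 hg2] with ξ hξ
  rw [hξ]
  refine (pow_le_pow_left' ?_ 2).trans hL1
  have h3 : ‖𝓕 g ξ‖ₑ ≤ ∫⁻ x, ‖g x‖ₑ := by
    rw [Real.fourier_real_eq]
    refine (enorm_integral_le_lintegral_enorm _).trans_eq (lintegral_congr fun x => ?_)
    rw [← ofReal_norm, Circle.norm_smul, ofReal_norm]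
  rwa [← eLpNorm_one_eq_lintegral_enorm, hg, eLpNorm_indicator_eq_eLpNorm_restrict hJ] at h3

/-- The Hilbert–Schmidt bound for the product of a position and a momentum projection. -/
theorem enorm_indicatorOp_fourierL2_indicatorOp_le {J J' : Set ℝ} (hJ : MeasurableSet J)
    (hJ' : MeasurableSet J') (hJv : volume J ≠ ∞) (u : L2R) :
    ‖indicatorOp J' (fourierL2 (indicatorOp J u))‖ₑ ^ 2 ≤
      volume J * volume J' * ‖indicatorOp J u‖ₑ ^ 2 := by
  rw [enorm_indicatorOp_sq hJ']
  refine (lintegral_mono_ae (ae_restrict_of_ae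
    (enorm_fourierL2_indicatorOp_le hJ hJv u))).trans_eq ?_
  rw [lintegral_const, Measure.restrict_apply_univ]
  ring

theorem volume_interval (x w : ℝ) : volume (interval x w) = ENNReal.ofReal w := by
  rw [interval, Real.volume_Icc]
  congr 1
  ring

theorem le_tsum_norm_sq_of_eq_tsum_enorm {ι : Type*} {f : ι → L2R} {m : ℝ≥0∞} {c : ℝ}
    (hm : m = ∑' i, ‖f i‖ₑ ^ 2) (hfin : m ≠ ∞) (h : ENNReal.ofReal c ≤ m) :
    c ≤ ∑' i, ‖f i‖ ^ 2 := by
  have h1 : m.toReal = ∑' i, ‖f i‖ ^ 2 := by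
    rw [hm, ENNReal.tsum_toReal_eq fun i => by finiteness]
    simp
  rw [← h1]
  exact (ENNReal.ofReal_le_iff_le_toReal hfin).1 h

/-- If in some state position and momentum are confined to intervals of lengths `w₁`, `w₂` with
probabilities `1 - ε₁`, `1 - ε₂`, then `w₁ w₂ ≥ 2πħ K(ε₁, ε₂)`. -/
theorem DensityOperator.uffinkK_le_mul {ħ : ℝ} (hħ : 0 < ħ) (ρ : DensityOperator L2R)
    {ε₁ ε₂ : ℝ} (hε₁ : ε₁ ∈ Set.Ioo 0 1) (hε₂ : ε₂ ∈ Set.Ioo 0 1) (hε : ε₁ + ε₂ < 1)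
    {x₁ x₂ w₁ w₂ : ℝ} (hw₁ : 0 < w₁) (hw₂ : 0 < w₂)
    (h₁ : ENNReal.ofReal (1 - ε₁) ≤ ρ.bornMeasure position (interval x₁ w₁))
    (h₂ : ENNReal.ofReal (1 - ε₂) ≤ ρ.bornMeasure (momentum ħ) (interval x₂ w₂)) :
    2 * Real.pi * ħ * uffinkK ε₁ ε₂ ≤ w₁ * w₂ := by
  have hc : 0 < 2 * Real.pi * ħ := by positivity
  set f : traceIndex L2R → L2R := fun i => ρ.root (traceBasis L2R i) with hf
  set J := interval x₁ w₁
  -- The momentum interval in the frequency variable; its rescaled length puts `2πħ` into the final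
  -- bound.
  set J' := interval (x₂ / (2 * Real.pi * ħ)) (w₂ / (2 * Real.pi * ħ))
  have hJ : MeasurableSet J := measurableSet_interval _ _
  have hJ' : MeasurableSet J' := measurableSet_interval _ _
  have hJv : volume J = ENNReal.ofReal w₁ := volume_interval _ _
  have hJv' : volume J' = ENNReal.ofReal (w₂ / (2 * Real.pi * ħ)) := volume_interval _ _
  set A : L2R → L2R := fun u => indicatorOp J u with hA
  set B : L2R → L2R := fun u => fourierL2.symm (indicatorOp J' (fourierL2 u)) with hB
  have hsq : ∀ u : L2R, ⟪u, u⟫_ℂ = ((‖u‖ ^ 2 : ℝ) : ℂ) := fun u => by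
    rw [inner_self_eq_norm_sq_to_K]; norm_cast
  have hPA : ∀ u, ⟪u, A u⟫_ℂ = ((‖A u‖ ^ 2 : ℝ) : ℂ) := fun u => by
    rw [hA]
    simp only
    rw [inner_indicatorOp hJ, hsq]
  have hPB : ∀ u, ⟪u, B u⟫_ℂ = ((‖B u‖ ^ 2 : ℝ) : ℂ) := fun u => by
    rw [hB]
    simp only
    rw [inner_symm_apply fourierL2, inner_indicatorOp hJ', hsq, LinearIsometryEquiv.norm_map]
  set c := √(w₁ * (w₂ / (2 * Real.pi * ħ))) with hcdef
  have hAB : ∀ u v, (⟪A u, B v⟫_ℂ).re ≤ c * (‖A u‖ * ‖B v‖) := fun u v => by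
    have h3 : ‖indicatorOp J' (fourierL2 (A u))‖ ≤ c * ‖A u‖ := by
      have h4 := enorm_indicatorOp_fourierL2_indicatorOp_le hJ hJ' (by rw [hJv]; finiteness) u
      rw [hJv, hJv', ← ENNReal.ofReal_mul hw₁.le, ← ofReal_norm, ← ofReal_norm,
        ← ENNReal.ofReal_pow (norm_nonneg _), ← ENNReal.ofReal_pow (norm_nonneg _),
        ← ENNReal.ofReal_mul (by positivity), ENNReal.ofReal_le_ofReal_iff (by positivity)] at h4
      refine le_of_sq_le_sq ?_ (by positivity)
      rw [mul_pow, hcdef, Real.sq_sqrt (by positivity)]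
      exact h4
    calc (⟪A u, B v⟫_ℂ).re ≤ ‖⟪A u, B v⟫_ℂ‖ := Complex.re_le_norm _
      _ = ‖⟪indicatorOp J' (fourierL2 (A u)), indicatorOp J' (fourierL2 v)⟫_ℂ‖ := by
        rw [hB]
        simp only
        rw [inner_symm_apply fourierL2, inner_indicatorOp hJ']
      _ ≤ ‖indicatorOp J' (fourierL2 (A u))‖ * ‖indicatorOp J' (fourierL2 v)‖ :=
        norm_inner_le_norm _ _
      _ ≤ c * ‖A u‖ * ‖indicatorOp J' (fourierL2 v)‖ := by gcongr
      _ = c * (‖A u‖ * ‖B v‖) := by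
        rw [hB]
        simp only
        rw [LinearIsometryEquiv.norm_map, mul_assoc]
  have hfs : HasSum (fun i => ‖f i‖ ^ 2) 1 := by
    have h5 := ρ.tsum_enorm_root
    have h6 : ∑' i, ‖f i‖ ^ 2 = 1 := by
      have h7 := congrArg ENNReal.toReal h5
      rw [ENNReal.tsum_toReal_eq fun i => by finiteness] at h7
      simpa using h7
    rw [← h6]
    exact ρ.summable_norm_root.hasSum
  have hsum₁ : ρ.bornMeasure position J = ∑' i, ‖A (f i)‖ₑ ^ 2 := by
    rw [ρ.bornMeasure_position ρ.op_eq_root hJ]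
    exact tsum_congr fun i => (enorm_indicatorOp_sq hJ _).symm
  have hsum₂ : ρ.bornMeasure (momentum ħ) (interval x₂ w₂) = ∑' i, ‖B (f i)‖ₑ ^ 2 := by
    rw [ρ.bornMeasure_momentum ħ ρ.op_eq_root (measurableSet_interval _ _),
      preimage_mul_interval hc]
    refine tsum_congr fun i => ?_
    rw [← enorm_indicatorOp_sq hJ', hB, ← ofReal_norm, ← ofReal_norm,
      LinearIsometryEquiv.norm_map]
  have hlp := landau_pollak_of_hasSum hfs hPA hPB (Real.sqrt_nonneg _) hAB hε₁.2 hε₂.2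
    (le_tsum_norm_sq_of_eq_tsum_enorm hsum₁ (measure_ne_top _ _) h₁)
    (le_tsum_norm_sq_of_eq_tsum_enorm hsum₂ (measure_ne_top _ _) h₂)
  -- Since `(1 - ε₁)(1 - ε₂) - ε₁ ε₂ = 1 - ε₁ - ε₂ > 0`, the Landau–Pollak bound may be squared.
  have hnn : 0 ≤ √((1 - ε₁) * (1 - ε₂)) - √(ε₁ * ε₂) := by
    rw [sub_nonneg]
    exact Real.sqrt_le_sqrt (by linarith)
  have hK : uffinkK ε₁ ε₂ ≤ w₁ * (w₂ / (2 * Real.pi * ħ)) := by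
    rw [uffinkK, ← Real.sq_sqrt (show 0 ≤ w₁ * (w₂ / (2 * Real.pi * ħ)) by positivity)]
    exact pow_le_pow_left₀ hnn hlp 2
  calc 2 * Real.pi * ħ * uffinkK ε₁ ε₂
      ≤ 2 * Real.pi * ħ * (w₁ * (w₂ / (2 * Real.pi * ħ))) := by gcongr
    _ = w₁ * w₂ := by field_simp

/-- Uffink's uncertainty relation for the overall widths of position and momentum. -/
theorem DensityOperator.uffinkK_le_overallWidth_mul {ħ : ℝ} (hħ : 0 < ħ) (ρ : DensityOperator L2R)
    {ε₁ ε₂ : ℝ} (hε₁ : ε₁ ∈ Set.Ioo 0 1) (hε₂ : ε₂ ∈ Set.Ioo 0 1) (hε : ε₁ + ε₂ < 1) :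
    ENNReal.ofReal (2 * Real.pi * ħ * uffinkK ε₁ ε₂) ≤
      overallWidth ε₁ (ρ.bornMeasure position) * overallWidth ε₂ (ρ.bornMeasure (momentum ħ)) := by
  set W₂ := overallWidth ε₂ (ρ.bornMeasure (momentum ħ)) with hW₂
  have hfin : W₂ ≠ ∞ := overallWidth_ne_top _ hε₂.1
  have key : ∀ w₁ : ℝ, 0 < w₁ →
      (∃ x, ENNReal.ofReal (1 - ε₁) ≤ ρ.bornMeasure position (interval x w₁)) →
      ENNReal.ofReal (2 * Real.pi * ħ * uffinkK ε₁ ε₂) ≤ ENNReal.ofReal w₁ * W₂ := by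
    rintro w₁ hw₁ ⟨x₁, h₁⟩
    have h0 : ENNReal.ofReal w₁ ≠ 0 := by simpa using hw₁
    rw [mul_comm (ENNReal.ofReal w₁), ← ENNReal.div_le_iff h0 ENNReal.ofReal_ne_top, hW₂]
    refine le_iInf fun w₂ => le_iInf₂ fun hw₂ ⟨x₂, h₂⟩ => ?_
    rw [ENNReal.div_le_iff h0 ENNReal.ofReal_ne_top, mul_comm (ENNReal.ofReal w₂),
      ← ENNReal.ofReal_mul hw₁.le]
    exact ENNReal.ofReal_le_ofReal (ρ.uffinkK_le_mul hħ hε₁ hε₂ hε hw₁ hw₂ h₁ h₂)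
  -- Division by `W₂` is unavailable when it vanishes; then any single admissible `w₁` already
  -- forces the left side to be zero.
  rcases eq_or_ne W₂ 0 with h0 | h0
  · obtain ⟨w₁, hw₁, h₁⟩ := exists_interval_ge (ρ.bornMeasure position) hε₁.1
    have := key w₁ hw₁ ⟨0, h₁⟩
    rw [h0, mul_zero] at this
    exact this.trans zero_le
  · rw [← ENNReal.div_le_iff h0 hfin]
    refine le_iInf fun w₁ => le_iInf₂ fun hw₁ h₁ => ?_
    rw [ENNReal.div_le_iff h0 hfin]
    exact key w₁ hw₁ h₁

end PhaseSpace

end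

/-! ### Marginals and error bar relations of the covariant observable. -/

theorem mainTheorem3 (ħ : ℝ) (hħ : 0 < ħ) (τ : DensityOperator L2R) :
    (∀ X : Set ℝ, MeasurableSet X →
      covariantObservable ħ τ (X ×ˢ Set.univ) = (smearedPosition (positionNoise τ)).effect X) ∧
    (∀ Y : Set ℝ, MeasurableSet Y →
      covariantObservable ħ τ (Set.univ ×ˢ Y) = (smearedMomentum ħ (momentumNoise ħ τ)).effect Y) ∧
    ∀ ε₁ ∈ Set.Ioo (0 : ℝ) 1, ∀ ε₂ ∈ Set.Ioo (0 : ℝ) 1,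
      grossErrorBarWidth ε₁ (smearedPosition (positionNoise τ)) position ≠ ⊤ ∧
      grossErrorBarWidth ε₂ (smearedMomentum ħ (momentumNoise ħ τ)) (momentum ħ) ≠ ⊤ ∧
      biasFreeErrorBarWidth ε₁ (smearedPosition (positionNoise τ)) position *
          biasFreeErrorBarWidth ε₂ (smearedMomentum ħ (momentumNoise ħ τ)) (momentum ħ) ≤
        grossErrorBarWidth ε₁ (smearedPosition (positionNoise τ)) position *
          grossErrorBarWidth ε₂ (smearedMomentum ħ (momentumNoise ħ τ)) (momentum ħ) ∧
      (ε₁ + ε₂ < 1 →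
        ENNReal.ofReal (2 * Real.pi * ħ * uffinkK ε₁ ε₂) ≤
          biasFreeErrorBarWidth ε₁ (smearedPosition (positionNoise τ)) position *
            biasFreeErrorBarWidth ε₂ (smearedMomentum ħ (momentumNoise ħ τ)) (momentum ħ)) := by
  refine ⟨fun X hX => covariantObservable_prod_univ hħ τ hX,
    fun Y hY => covariantObservable_univ_prod hħ τ hY, fun ε₁ hε₁ ε₂ hε₂ => ⟨?_, ?_, ?_, ?_⟩⟩
  · exact grossErrorBarWidth_ne_top (fun ρ => ρ.bornMeasure_smearedPosition _) hε₁.1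
  · exact grossErrorBarWidth_ne_top (fun ρ => ρ.bornMeasure_smearedMomentum ħ _) hε₂.1
  · exact mul_le_mul' (biasFreeErrorBarWidth_le _ _ _) (biasFreeErrorBarWidth_le _ _ _)
  · intro hε
    -- The two noises are the position and momentum distributions of this one state, so a
    -- preparation uncertainty relation bounds the measurement errors.
    refine ((τ.conj parity).uffinkK_le_overallWidth_mul hħ hε₁ hε₂ hε).trans (mul_le_mul' ?_ ?_)
    · exact overallWidth_le_biasFreeErrorBarWidth (μ := positionNoise τ)
        (fun ρ => ρ.bornMeasure_smearedPosition _) (fun δ hδ => exists_localised_position hδ) ε₁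
    · exact overallWidth_le_biasFreeErrorBarWidth (μ := momentumNoise ħ τ)
        (fun ρ => ρ.bornMeasure_smearedMomentum ħ _)
        (fun δ hδ => exists_localised_momentum hħ hδ) ε₂
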